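/- Let $K$ be an oriented virtual link diagram with $n$ classical crossings, enumerated $1,\dots,n$, of which $n_+$ are positive and $n_-$ negative. Let $R$ be a ring. **Atom.** The atom of $K$ is the closed surface whose frame is the four-valent graph with the classical crossings as vertices and the branches between them as edges, to which black and white discs are attached so that every edge has a black and a white side. If the half-edges at a crossing are $x_1,x_2,x_3,x_4$ in clockwise order with $x_1,x_3$ forming the undercrossing, then the angles $(x_1,x_2)$, $(x_3,x_4)$ are black and the other two are white. **State cube.** A state $s\in\{0,1\}^n$ chooses the $A$-smoothing ($0$) or the $B$-smoothing ($1$) at every classical crossing; $\beta(s)$ is the number of $B$-smoothings. The smoothed diagram consists of circles, which pass straight through virtual crossings. Let $V$ be free with basis $1,X$, where $\deg 1=1$ and $\deg X=-1$. A generator over $s$ labels each circle of $s$ by $1$ or $X$. It has height $\beta(s)-n_-$ and grading $\sum\deg+\beta(s)+n_+-2n_-$. An edge $s\to t$ of the cube changes one crossing $v$ from $A$ to $B$. It carries a partial differential, which leaves the labels of the circles not touching $v$ unchanged. **Usual complex.** The chain space of $s$ is the unordered tensor product of the spaces $V$ over its circles. The partial differential at $v$ is $(-1)^{\#\{w<v\,:\,s_w=1\}}$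 times * $m$ for a $2\to1$ bifurcation: $m(1\otimes1)=1$, $m(1\otimes X)=m(X\otimes1)=X$, $m(X\otimes X)=0$; * $\Delta$ for a $1\to2$ bifurcation: $\Delta(1)=1\otimes X+X\otimes1$, $\Delta(X)=X\otimes X$. The differential is the sum of the partial ones. Let $Kh'(K)^{i,j}$ be the homology with coefficients in $R$ in height $i$ and grading $j$. (If the atom is orientable, no $1\to1$ bifurcations occur.) **New complex.** The space of a circle $C$ has basis $1$, $X_{C,o}$, where $o$ is an orientation of $C$ and $X_{C,-o}=-X_{C,o}$. The chain space of $s$ is the ordered tensor product of the spaces of its circles: permuting factors multiplies $x_1\wedge\dots\wedge x_k$ by the sign of the permutation, all elements (including $1$) being odd. For the differential at $v$, draw $v$ with both strands directed upwards. Orient the right half-edges at $v$ as the link and the left ones oppositely. This orients the circles at $v$ and so fixes their generators $X$ (this is well defined unless the bifurcation is $1\to1$). If two different circles meet at $v$, the left (resp. upper) one is the first and the right (resp. lower) one is the second. Bring the circles at $v$ to the first positions and apply $$m(1_1\wedge1_2)=1,\quad m(X_1\wedge1_2)=m(1_1\wedge X_2)=X,\quad m(X_1\wedge X_2)=0,$$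 $$\Delta(1)=1_1\wedge X_2+X_1\wedge1_2,\quad \Delta(X)=X_1\wedge X_2,$$ to them. For a $1\to1$ bifurcation the partial differential is $0$. The differential is the sum of the partial ones, and $Kh(K)^{i,j}$ is the homology with coefficients in $R$ in height $i$ and grading $j$. Bases of the chain spaces are fixed by any choice, for every state, of an ordering of its circles and an orientation of each of them. **Theorem.** Suppose that the atom of $K$ is orientable. Then, for every such choice of bases, both differentials square to zero, and for all $i,j\in\mathbb Z$ there is an isomorphism of $R$-modules $Kh(K)^{i,j}\cong Kh'(K)^{i,j}$. -/

import Mathlib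

noncomputable section

namespace VirtualKhovanov

/-! ### Oriented virtual link diagrams -/

/-- The four half-edges at a crossing of an oriented diagram, where the crossing is drawn with both
strands directed upwards: the strands run from `sw` to `ne` and from `se` to `nw`. -/
inductive Corner
  | ne | nw | sw | se
  deriving DecidableEq

instance : Fintype Corner :=
  ⟨{Corner.ne, Corner.nw, Corner.sw, Corner.se}, fun c => by cases c <;> decide⟩

namespace Corner

/-- The half-edges that the link orientation directs away from the crossing. -/
def outgoing : Corner → Bool
  | ne => true | nw => true | sw => false | se => false

/-- Counterclockwise rotation around the crossing. -/
def ccw : Corner → Corner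
  | ne => nw | nw => sw | sw => se | se => ne

/-- Clockwise rotation around the crossing. -/
def cw : Corner → Corner
  | ne => se | se => sw | sw => nw | nw => ne

/-- Going straight through the crossing. -/
def straight : Corner → Corner
  | ne => sw | sw => ne | nw => se | se => nw

/-- The smoothing with a left arc `nw - sw` and a right arc `ne - se`. -/
def vertical : Corner → Corner
  | ne => se | se => ne | nw => sw | sw => nw

/-- The smoothing with an upper arc `nw - ne` and a lower arc `sw - se`. -/
def horizontal : Corner → Corner
  | ne => nw | nw => ne | se => sw | sw => se

/-- At a positive crossing the strand from `sw` to `ne` is the overcrossing, at a negative crossing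
the strand from `se` to `nw` is. -/
def isOver : (positive : Bool) → Corner → Bool
  | true, ne => true | true, sw => true | true, nw => false | true, se => false
  | false, ne => false | false, sw => false | false, nw => true | false, se => true

/-- The smoothing of type `A` (`b = false`) or `B` (`b = true`) of a classical crossing. The
`A`-smoothing joins the two regions swept by the overcrossing turned counterclockwise towards
the undercrossing. -/
def smoothing (positive b : Bool) : Corner → Corner :=
  if positive = b then horizontal else vertical

/-- Local orientations of the half-edges at a crossing which serve to fix the generator `X`: they
agree with the link orientation on the right (`ne`, `se`) and disagree with it on the left.
`true` means: directed away from the crossing. -/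
def localDir : Corner → Bool
  | ne => true | se => false | nw => false | sw => true

end Corner

/-- Half-edges of a diagram with `n` classical and `m` virtual crossings. -/
abbrev HalfEdge (n m : ℕ) : Type := (Fin n ⊕ Fin m) × Corner

/-- An oriented virtual diagram (up to planar isotopy): a four-valent graph in the plane with `n`
enumerated classical crossings, each positive or negative, `m` virtual crossings, and `loops`
components without any crossing. `edge` sends a half-edge to the other half of its edge. The graph
is recorded by the cyclic order of half-edges at the crossings; it is planar by Euler's formula,
`#crossings - #edges + #faces = 2 #components` (where `#edges = 2 #crossings`). -/
structure VirtualDiagram where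
  n : ℕ
  m : ℕ
  loops : ℕ
  positive : Fin n → Bool
  edge : HalfEdge n m → HalfEdge n m
  edge_invol : ∀ h, edge (edge h) = h
  edge_outgoing : ∀ h, (edge h).2.outgoing = !h.2.outgoing
  planar :
    Nat.card (Quot fun h h' : HalfEdge n m => h' = ((edge h).1, (edge h).2.ccw)) =
      (n + m) + 2 * Nat.card
        (Quot fun h h' : HalfEdge n m => h' = edge h ∨ h' = (h.1, h.2.ccw))

/-! ### Atoms -/

/-- A closed surface cut into polygons by a graph, given by its flags (vertex, edge end, side):
`t0` passes to the other end of the edge, `t1` to the other edge of the same polygon at the same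
vertex, `t2` to the other side of the edge. The polygons are coloured black and white so that
different colours meet along every edge. -/
structure Atom where
  Flag : Type
  t0 : Flag → Flag
  t1 : Flag → Flag
  t2 : Flag → Flag
  black : Flag → Bool
  t0_t0 : ∀ f, t0 (t0 f) = f
  t1_t1 : ∀ f, t1 (t1 f) = f
  t2_t2 : ∀ f, t2 (t2 f) = f
  t0_ne : ∀ f, t0 f ≠ f
  t1_ne : ∀ f, t1 f ≠ f
  t2_ne : ∀ f, t2 f ≠ f
  t0_t2 : ∀ f, t0 (t2 f) = t2 (t0 f)
  t0_t2_ne : ∀ f, t0 (t2 f) ≠ f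
  black_t0 : ∀ f, black (t0 f) = black f
  black_t1 : ∀ f, black (t1 f) = black f
  black_t2 : ∀ f, black (t2 f) = !black f

/-- The underlying surface is orientable: flags (the triangles of the barycentric subdivision) can
be oriented so that neighbouring ones are oriented coherently. -/
def Atom.IsOrientable (S : Atom) : Prop :=
  ∃ c : S.Flag → Bool, ∀ f, c (S.t0 f) = !c f ∧ c (S.t1 f) = !c f ∧ c (S.t2 f) = !c f

/-- The partner of a half-edge in a black (`k = true`) or white (`k = false`) angle at a classical
crossing: a black angle goes clockwise from an undercrossing half-edge to an overcrossing one. -/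
def Corner.angle (positive k : Bool) (c : Corner) : Corner :=
  if c.isOver positive = k then c.ccw else c.cw

namespace VirtualDiagram

variable (K : VirtualDiagram)

/-- The other half-edge at the same point of the atom in the black or white cell. A branch simply
passes through a virtual crossing. -/
def angle (k : Bool) : HalfEdge K.n K.m → HalfEdge K.n K.m
  | (Sum.inl v, c) => (Sum.inl v, c.angle (K.positive v) k)
  | (Sum.inr w, c) => (Sum.inr w, c.straight)

theorem angle_angle (k : Bool) (h : HalfEdge K.n K.m) : K.angle k (K.angle k h) = h := by
  obtain ⟨v | w, c⟩ := h
  · simp only [angle]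
    cases K.positive v <;> cases k <;> cases c <;> rfl
  · cases c <;> rfl

theorem angle_ne (k : Bool) (h : HalfEdge K.n K.m) : K.angle k h ≠ h := by
  obtain ⟨v | w, c⟩ := h
  · simp only [angle]
    cases K.positive v <;> cases k <;> cases c <;> simp [Corner.angle, Corner.isOver, Corner.ccw,
      Corner.cw]
  · cases c <;> simp [angle, Corner.straight]

theorem edge_ne (h : HalfEdge K.n K.m) : K.edge h ≠ h := by
  intro e
  have := K.edge_outgoing h
  rw [e] at this
  cases hh : h.2.outgoing <;> simp [hh] at this

/-- The atom of a virtual diagram. Its frame has the classical crossings as four-valent vertices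
and the branches between them as edges (the points of a branch at virtual crossings are kept as
bivalent points of the edge). Every half-edge `h` has a black side `(h, true)` and a white side
`(h, false)`. -/
def atom : Atom where
  Flag := HalfEdge K.n K.m × Bool
  t0 f := (K.edge f.1, f.2)
  t1 f := (K.angle f.2 f.1, f.2)
  t2 f := (f.1, !f.2)
  black f := f.2
  t0_t0 f := by simp [K.edge_invol]
  t1_t1 f := by simp [K.angle_angle]
  t2_t2 f := by simp
  t0_ne f h := K.edge_ne f.1 (congrArg Prod.fst h)
  t1_ne f h := K.angle_ne f.2 f.1 (congrArg Prod.fst h)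
  t2_ne f h := by simpa using congrArg Prod.snd h
  t0_t2 f := rfl
  t0_t2_ne f h := by simpa using congrArg Prod.snd h
  black_t0 f := rfl
  black_t1 f := rfl
  black_t2 f := rfl

/-! ### The state cube -/

/-- States: `false` is the `A`-smoothing and `true` the `B`-smoothing. -/
abbrev State : Type := Fin K.n → Bool

/-- The points by which circles are recorded: the half-edges, and one point on every component
without crossings. -/
abbrev Point : Type := HalfEdge K.n K.m ⊕ Fin K.loops

/-- The half-edge joined to a given one by the smoothed diagram (virtual crossings remain). -/
def arc (s : K.State) : HalfEdge K.n K.m → HalfEdge K.n K.m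
  | (Sum.inl v, c) => (Sum.inl v, c.smoothing (K.positive v) (s v))
  | (Sum.inr w, c) => (Sum.inr w, c.straight)

/-- Two points are neighbours on a circle of the state `s`. -/
def Step (s : K.State) : K.Point → K.Point → Prop
  | Sum.inl h, Sum.inl h' => h' = K.edge h ∨ h' = K.arc s h
  | _, _ => False

/-- The circle of the state `s` through a point. -/
def circleOf (s : K.State) (x : K.Point) : Set K.Point := {y | Relation.EqvGen (K.Step s) x y}

/-- The set of circles of a state. -/
def circles (s : K.State) : Set (Set K.Point) := Set.range (K.circleOf s)

abbrev Circle (s : K.State) : Type := {C : Set K.Point // C ∈ K.circles s}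

def circle (s : K.State) (x : K.Point) : K.Circle s := ⟨K.circleOf s x, x, rfl⟩

instance (s : K.State) : Fintype (K.Circle s) := Fintype.ofFinite _

instance (s : K.State) : DecidableEq (K.Circle s) := Classical.decEq _

/-- The circle containing the left, resp. upper, arc at the classical crossing `v`. (The half-edge
`nw` lies on the left arc of one smoothing and on the upper arc of the other one.) -/
def fst (s : K.State) (v : Fin K.n) : K.Circle s := K.circle s (Sum.inl (Sum.inl v, Corner.nw))

/-- The circle containing the right, resp. lower, arc at the classical crossing `v`. -/
def snd (s : K.State) (v : Fin K.n) : K.Circle s := K.circle s (Sum.inl (Sum.inl v, Corner.se))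

/-- The edge of the state cube from `s` to `t` in the direction of the crossing `v`. -/
def IsEdge (v : Fin K.n) (s t : K.State) : Prop := s v = false ∧ t = Function.update s v true

/-- A `2 → 1` bifurcation. -/
def IsMerge (v : Fin K.n) (s t : K.State) : Prop := K.fst s v ≠ K.snd s v ∧ K.fst t v = K.snd t v

/-- A `1 → 2` bifurcation. -/
def IsSplit (v : Fin K.n) (s t : K.State) : Prop := K.fst s v = K.snd s v ∧ K.fst t v ≠ K.snd t v

end VirtualDiagram

/-- The two generators of the space of a circle. -/
inductive Label
  | one | X
  deriving DecidableEq

instance : Fintype Label := ⟨{Label.one, Label.X}, fun p => by cases p <;> decide⟩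

namespace Label

/-- The coefficient of `r` in `m(p, q)`. -/
def mulCoeff : (p q r : Label) → ℤ
  | one, one, one => 1
  | one, X, X => 1
  | X, one, X => 1
  | _, _, _ => 0

/-- The coefficient of `q, r` in `Δ(p)`. -/
def comulCoeff : (p q r : Label) → ℤ
  | one, one, X => 1
  | one, X, one => 1
  | X, X, X => 1
  | _, _, _ => 0

def deg : Label → ℤ
  | one => 1
  | X => -1

end Label

/-- The number of inversions of a list with respect to a numbering `r` of its entries. -/
def inversions {α : Type*} (r : α → ℕ) : List α → ℕ
  | [] => 0
  | a :: l => l.countP (fun b => decide (r b < r a)) + inversions r l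

/-- The sign of the permutation that brings the entries of a list, taken in the order given by the
numbering `r`, to the order of the list. -/
def orderSign {α : Type*} (r : α → ℕ) (l : List α) : ℤ := (-1) ^ inversions r l

namespace VirtualDiagram

variable (K : VirtualDiagram)

/-! ### Enhanced states and gradings -/

/-- Basis elements of the chain space: a state with a generator `1` or `X` for every circle. -/
abbrev Enhanced : Type := Σ s : K.State, (K.Circle s → Label)

instance : Fintype K.Enhanced := Fintype.ofFinite _

/-- The number of `B`-smoothings of a state. -/
def beta (s : K.State) : ℕ := (Finset.univ.filter fun v => s v = true).card

def nPlus : ℕ := (Finset.univ.filter fun v => K.positive v = true).card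

def nMinus : ℕ := (Finset.univ.filter fun v => K.positive v = false).card

/-- The height, normalized by the shift `[-n₋]`. -/
def height (e : K.Enhanced) : ℤ := (K.beta e.1 : ℤ) - K.nMinus

/-- The grading, normalized by the shift `{n₊ - 2 n₋}`. -/
def grading (e : K.Enhanced) : ℤ :=
  (∑ C, (e.2 C).deg) + K.beta e.1 + (K.nPlus - 2 * K.nMinus)

/-- Basis elements of height `i` and grading `j`. -/
abbrev Gen (i j : ℤ) : Type := {e : K.Enhanced // K.height e = i ∧ K.grading e = j}

instance (i j : ℤ) : Fintype (K.Gen i j) := Fintype.ofFinite _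

/-- The chain space of height `i` and grading `j` with coefficients in `R`. -/
abbrev Chain (R : Type*) (i j : ℤ) : Type _ := K.Gen i j → R

/-- The linear map between chain spaces with given (integral) matrix: `coeff e e'` is the
coefficient of `e'` in the image of `e`. -/
def matrixMap (coeff : K.Enhanced → K.Enhanced → ℤ) (R : Type*) [Ring R] (i i' j : ℤ) :
    K.Chain R i j →ₗ[R] K.Chain R i' j where
  toFun f e' := ∑ e, coeff e.1 e'.1 • f e
  map_add' f g := by
    funext e'
    simp [Finset.sum_add_distrib]
  map_smul' r f := by
    funext e'
    simp only [Pi.smul_apply, smul_eq_mul, Finset.mul_sum, RingHom.id_apply, mul_smul_comm]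

/-- Circles common to both states carry the same generator. -/
def Compatible (e e' : K.Enhanced) : Prop :=
  ∀ (C : K.Circle e.1) (C' : K.Circle e'.1), C.1 = C'.1 → e.2 C = e'.2 C'

/-! ### The usual Khovanov complex -/

open Classical in
/-- Matrix entry of the partial differential of the usual complex at the crossing `v`: `m` or `Δ`
on unordered tensor products, with the sign `(-1)^k`, where `k` is the number of `B`-smoothings at
the crossings that precede `v`. -/
def usualEdgeCoeff (v : Fin K.n) (e e' : K.Enhanced) : ℤ :=
  if K.IsEdge v e.1 e'.1 ∧ K.Compatible e e' then
    (-1) ^ (Finset.univ.filter fun w => w < v ∧ e.1 w = true).card *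
    (if K.IsMerge v e.1 e'.1 then
      Label.mulCoeff (e.2 (K.fst e.1 v)) (e.2 (K.snd e.1 v)) (e'.2 (K.fst e'.1 v))
    else if K.IsSplit v e.1 e'.1 then
      Label.comulCoeff (e.2 (K.fst e.1 v)) (e'.2 (K.fst e'.1 v)) (e'.2 (K.snd e'.1 v))
    else 0)
  else 0

/-- The block of the usual differential between the heights `i` and `i'`. -/
def usualD (R : Type*) [Ring R] (i i' j : ℤ) : K.Chain R i j →ₗ[R] K.Chain R i' j :=
  K.matrixMap (fun e e' => ∑ v, K.usualEdgeCoeff v e e') R i i' j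

/-- The usual Khovanov homology in height `i` and grading `j`: cycles modulo boundaries. -/
abbrev UsualKh (R : Type*) [Ring R] (i j : ℤ) : Type _ :=
  LinearMap.ker (K.usualD R i (i + 1) j) ⧸
    (LinearMap.range (K.usualD R (i - 1) i j)).comap (LinearMap.ker (K.usualD R i (i + 1) j)).subtype

/-! ### The complex with ordered tensor products and oriented circles -/

/-- For every state, a numbering of its circles and an orientation of them. This chooses the basis
`p₁ ∧ ⋯ ∧ pₖ` of the ordered tensor product, where the `p`'s are `1` or `X_{C,o}`, the circles `C`
are taken in increasing order and have the chosen orientations `o`.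
Here `dir s h = true` means that the circle is directed away from the crossing at the half-edge `h`;
at a component without crossings, `true` and `false` stand for its two orientations. -/
structure Frame where
  ord : K.State → Set K.Point → ℕ
  dir : K.State → K.Point → Bool
  ord_inj : ∀ s, Set.InjOn (ord s) (K.circles s)
  dir_edge : ∀ s h, dir s (Sum.inl (K.edge h)) = !dir s (Sum.inl h)
  dir_arc : ∀ s h, dir s (Sum.inl (K.arc s h)) = !dir s (Sum.inl h)

namespace Frame

variable {K} (F : K.Frame)

/-- The sign `±1` in `X_{C,o} = ± X_v` for the circle `C` of the state `s` through the corner `c`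
at `v`, where `o` is the chosen orientation and `X_v` is the generator given by the local
orientation at `v`. -/
def localSign (s : K.State) (v : Fin K.n) (c : Corner) : ℤ :=
  if F.dir s (Sum.inl (Sum.inl v, c)) = c.localDir then 1 else -1

/-- The coefficient that expresses a generator (`1` or `X_{C,o}`) through the local one
(`1` or `X_v`). -/
def change (s : K.State) (v : Fin K.n) (c : Corner) : Label → ℤ
  | Label.one => 1
  | Label.X => F.localSign s v c

open Classical in
/-- The sign that compares the chosen orientations of a circle common to the states `s`, `t`. -/
def compareSign (s t : K.State) (C : Set K.Point) : ℤ :=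
  if ∀ x ∈ C, F.dir s x = F.dir t x then 1 else -1

/-- The circles common to the states `s` and `t`, listed in some order. -/
def common (s t : K.State) : List (Set K.Point) :=
  (Set.toFinite (K.circles s ∩ K.circles t)).toFinset.toList

open Classical in
/-- The sign that comes from the circles common to `e` and `e'`: the product of the orientation
signs over those that are labelled `X`. -/
def commonSign (e e' : K.Enhanced) : ℤ :=
  ∏ C : K.Circle e.1,
    if C.1 ∈ K.circles e'.1 ∧ e.2 C = Label.X then F.compareSign e.1 e'.1 C.1 else 1

open Classical in
/-- Matrix entry of the partial differential at the crossing `v`. The circles at `v` are brought to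
the first positions, all generators at `v` are expressed by the local ones, and
`m` or `Δ` is applied; the partial differential of a `1 → 1` bifurcation is zero. -/
def edgeCoeff (v : Fin K.n) (e e' : K.Enhanced) : ℤ :=
  if K.IsEdge v e.1 e'.1 ∧ K.Compatible e e' then
    if K.IsMerge v e.1 e'.1 then
      F.commonSign e e' *
      orderSign (F.ord e.1) ((K.fst e.1 v).1 :: (K.snd e.1 v).1 :: common e.1 e'.1) *
      orderSign (F.ord e'.1) ((K.fst e'.1 v).1 :: common e.1 e'.1) *
      F.change e.1 v Corner.nw (e.2 (K.fst e.1 v)) *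
      F.change e.1 v Corner.se (e.2 (K.snd e.1 v)) *
      F.change e'.1 v Corner.nw (e'.2 (K.fst e'.1 v)) *
      Label.mulCoeff (e.2 (K.fst e.1 v)) (e.2 (K.snd e.1 v)) (e'.2 (K.fst e'.1 v))
    else if K.IsSplit v e.1 e'.1 then
      F.commonSign e e' *
      orderSign (F.ord e.1) ((K.fst e.1 v).1 :: common e.1 e'.1) *
      orderSign (F.ord e'.1) ((K.fst e'.1 v).1 :: (K.snd e'.1 v).1 :: common e.1 e'.1) *
      F.change e.1 v Corner.nw (e.2 (K.fst e.1 v)) *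
      F.change e'.1 v Corner.nw (e'.2 (K.fst e'.1 v)) *
      F.change e'.1 v Corner.se (e'.2 (K.snd e'.1 v)) *
      Label.comulCoeff (e.2 (K.fst e.1 v)) (e'.2 (K.fst e'.1 v)) (e'.2 (K.snd e'.1 v))
    else 0
  else 0

/-- The block of the differential between the heights `i` and `i'`. -/
def d (R : Type*) [Ring R] (i i' j : ℤ) : K.Chain R i j →ₗ[R] K.Chain R i' j :=
  K.matrixMap (fun e e' => ∑ v, F.edgeCoeff v e e') R i i' j

/-- The homology `Kh(K)` in height `i` and grading `j`: cycles modulo boundaries. -/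
abbrev Kh (R : Type*) [Ring R] (i j : ℤ) : Type _ :=
  LinearMap.ker (F.d R i (i + 1) j) ⧸
    (LinearMap.range (F.d R (i - 1) i j)).comap (LinearMap.ker (F.d R i (i + 1) j)).subtype

end Frame

end VirtualDiagram

/-! ### Circles can be numbered and oriented -/

theorem exists_alternating {α : Type*} (E M : Equiv.Perm α) (hE : ∀ x, E (E x) = x)
    (hM : ∀ x, M (M x) = x) (hE' : ∀ x, E x ≠ x) (hM' : ∀ x, M x ≠ x) :
    ∃ d : α → Bool, ∀ x, d (E x) = !d x ∧ d (M x) = !d x := by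
  classical
  have hEE : E * E = 1 := Equiv.ext hE
  have hMM : M * M = 1 := Equiv.ext hM
  have hEi : E⁻¹ = E := inv_eq_of_mul_eq_one_left hEE
  have hMi : M⁻¹ = M := inv_eq_of_mul_eq_one_left hMM
  set ρ := E * M with hρ
  have hconj : E * ρ * E⁻¹ = ρ⁻¹ := by
    rw [hρ, mul_inv_rev, hEi, hMi, ← mul_assoc, hEE, one_mul]
  have hpow : ∀ (j : ℤ) x, E ((ρ ^ j) x) = (ρ ^ (-j)) (E x) := by
    intro j x
    have h1 : E * ρ ^ j * E⁻¹ = ρ ^ (-j) := by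
      rw [← conj_zpow, hconj, inv_zpow, zpow_neg]
    have h2 : E * ρ ^ j = ρ ^ (-j) * E := by rw [← h1]; group
    exact congrArg (fun p : Equiv.Perm α => p x) h2
  have hno : ∀ x, ¬ ρ.SameCycle x (E x) := by
    rintro x ⟨k, hk⟩
    obtain ⟨j, hj | hj⟩ := Int.even_or_odd' k
    · apply hE' ((ρ ^ j) x)
      rw [hpow, ← hk, ← Equiv.Perm.mul_apply, ← zpow_add]
      congr 2
      omega
    · apply hM' ((ρ ^ j) x)
      apply E.injective
      rw [hpow, ← hk, ← Equiv.Perm.mul_apply, ← Equiv.Perm.mul_apply, ← hρ,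
        ← Equiv.Perm.mul_apply, ← zpow_add, ← zpow_one_add]
      congr 2
      omega
  have hmap : ∀ x y, ρ.SameCycle x y → ρ.SameCycle (E x) (E y) := by
    intro x y h
    have := h.conj (g := E)
    rwa [hconj, Equiv.Perm.sameCycle_inv] at this
  let o : α → Set α := fun x => {y | ρ.SameCycle x y}
  have ho : ∀ x y, ρ.SameCycle x y → o x = o y := by
    intro x y h
    ext z
    exact ⟨fun hz => h.symm.trans hz, fun hz => h.trans hz⟩
  have hone : ∀ x, o x ≠ o (E x) := by
    intro x h
    have h1 : E x ∈ o x := by rw [h]; exact Equiv.Perm.SameCycle.refl _ _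
    exact hno x h1
  have hEM : ∀ x, ρ.SameCycle x (E (M x)) := fun x => ⟨1, by simp [hρ]⟩
  have h1 : ∀ x, o (E (M x)) = o x := fun x => (ho _ _ (hEM x)).symm
  have h2 : ∀ x, o (M x) = o (E x) := fun x => by
    have := ho _ _ (hmap _ _ (hEM x))
    rw [hE] at this
    exact this.symm
  refine ⟨fun x => decide (WellOrderingRel (o x) (o (E x))), fun x => ?_⟩
  have key : decide (WellOrderingRel (o (E x)) (o x)) =
      !decide (WellOrderingRel (o x) (o (E x))) := by
    rcases trichotomous_of WellOrderingRel (o x) (o (E x)) with h | h | h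
    · simp [h, asymm_of WellOrderingRel h]
    · exact absurd h (hone x)
    · simp [h, asymm_of WellOrderingRel h]
  constructor
  · simpa only [hE] using key
  · simpa only [h1, h2] using key

namespace VirtualDiagram

theorem arc_arc (K : VirtualDiagram) (s : K.State) (h : HalfEdge K.n K.m) :
    K.arc s (K.arc s h) = h := by
  obtain ⟨v | w, c⟩ := h
  · simp only [arc]
    cases K.positive v <;> cases s v <;> cases c <;> rfl
  · cases c <;> rfl

theorem arc_ne (K : VirtualDiagram) (s : K.State) (h : HalfEdge K.n K.m) : K.arc s h ≠ h := by
  obtain ⟨v | w, c⟩ := h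
  · simp only [arc]
    cases K.positive v <;> cases s v <;> cases c <;> simp [Corner.smoothing, Corner.vertical,
      Corner.horizontal]
  · cases c <;> simp [arc, Corner.straight]

instance (K : VirtualDiagram) : Nonempty K.Frame := by
  classical
  have h : ∀ s : K.State, ∃ d : HalfEdge K.n K.m → Bool,
      ∀ x, d (K.edge x) = !d x ∧ d (K.arc s x) = !d x := fun s =>
    exists_alternating (Function.Involutive.toPerm K.edge K.edge_invol)
      (Function.Involutive.toPerm (K.arc s) (K.arc_arc s)) K.edge_invol (K.arc_arc s)
      K.edge_ne (K.arc_ne s)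
  choose d hd using h
  obtain ⟨f, hf⟩ := exists_injective_nat (Set K.Point)
  exact ⟨⟨fun _ => f, fun s => Sum.elim (d s) fun _ => true, fun s => hf.injOn,
    fun s x => (hd s x).1, fun s x => (hd s x).2⟩⟩

end VirtualDiagram

end VirtualKhovanov

end

/-!
The two complexes differ only by signs, and these signs form a coboundary.

An orientation of the atom, restricted to the black sides of the half-edges, is a *source-sink
structure*: an orientation of the branches whose directions alternate around every classical
crossing (`nonempty_sourceSink`). It orients all circles of all states coherently, so that the
circles of a state are the cycles of a permutation of the points of the diagram, and changing the
smoothing at a crossing multiplies this permutation by the transposition of the two incoming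
half-edges `a v`, `b v` there (`SourceSink.cube`). Hence a bifurcation either merges two circles or
splits one circle, and `1 → 1` bifurcations do not occur (`sameCycle_mul_swap_iff`).

*The usual complex.* The tensor product of the algebras `ℤ[X] / (X²)` over the circles of a state is
a quotient of the ring of polynomials in all points. Between these quotients, a merge is the
projection, and a split is multiplication by `X_a + X_b`; so the composition of two partial
differentials is multiplication by a product of such factors. The two products around a face are
congruent (`SwapCube.edgePoly_face`), hence the faces commute without the signs and anticommute
with them.

*Comparison.* If the circles are oriented by the source-sink structure, the local generators `X_v`
at a crossing differ from the global ones by one sign `ε_v`. It cancels in `m` and multiplies `Δ` by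
`ε_v`; for `ε_v = -1` the left or upper circle passes through `a v` in the `A`-smoothing and through
`b v` in the `B`-smoothing, and this transposition of the factors compensates `ε_v`. As all
generators are odd, the partial differential of the new complex thus becomes the usual map `m` or
`Δ` times a sign that depends only on the edge of the cube (`edgeCoeff_eq`): the sign of
`x_a ∧ x_b ∧ ⋯ ↦ x ∧ ⋯` or `x ∧ ⋯ ↦ x_a ∧ x_b ∧ ⋯` with respect to the chosen orders.

*The signs.* Replace a circle by its indicator function in the exterior algebra. Then the map of
ordered products along a merge is contraction with the linear form `f ↦ f (a v) - f (b v)`, and the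
map along a split is inverted by this contraction (`SwapCube.contract_vol`). Contractions
anticommute, which settles all faces but those where, seen from a suitable vertex, a pair of circles
is merged and split again in two ways. There the claim is that the two directions separate their
points in opposite ways before and after, which follows from the invariance of
`∑ x, g x * g' x` under the permutation (`SwapCube.separate_opposite`). So the signs, like the usual
ones, have product `-1` around every face (`SwapCube.edgeSign_face`); their quotient is a
coboundary (`exists_coboundary`), and rescaling the basis elements turns one complex into the other.
-/

noncomputable section

namespace VirtualKhovanov

/-! ### Cycles of a permutation multiplied by a transposition -/

section Perm

variable {α : Type*}

/-- An equivalence relation that relates every point to its image contains the relation of lying on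
the same cycle. -/
theorem rel_of_sameCycle {f : Equiv.Perm α} {r : α → α → Prop} (hr : Equivalence r)
    (h : ∀ x, r x (f x)) {x y : α} (hxy : f.SameCycle x y) : r x y := by
  obtain ⟨i, rfl⟩ := hxy
  induction i using Int.induction_on with
  | zero => exact hr.refl x
  | succ i ih =>
    rw [add_comm, zpow_one_add, Equiv.Perm.mul_apply]
    exact hr.trans ih (h _)
  | pred i ih =>
    have h' := h ((f ^ (-(i : ℤ) - 1)) x)
    rw [← Equiv.Perm.mul_apply, ← zpow_one_add, add_sub_cancel] at h'
    exact hr.trans ih (hr.symm h')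

variable [DecidableEq α] {f : Equiv.Perm α} {a b : α}

/-- As long as the orbit of `a` under `f` does not return to `a` or `b`, the orbit of `b` under
`f * swap a b` follows it. -/
theorem mul_swap_pow_apply {k : ℕ}
    (h : ∀ j, 0 < j → j < k → (f ^ j) a ≠ a ∧ (f ^ j) a ≠ b) {j : ℕ} (h0 : 0 < j) (hj : j ≤ k) :
    ((f * Equiv.swap a b) ^ j) b = (f ^ j) a := by
  induction j with
  | zero => omega
  | succ j ih =>
    rcases Nat.eq_zero_or_pos j with rfl | hj0
    · simp
    · rw [pow_succ', Equiv.Perm.mul_apply, ih hj0 (by omega), Equiv.Perm.mul_apply,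
        Equiv.swap_apply_of_ne_of_ne (h j hj0 (by omega)).1 (h j hj0 (by omega)).2,
        ← Equiv.Perm.mul_apply, ← pow_succ']

/-- Multiplication by the transposition of `a` and `b` separates `a` from `b` if they lie on the
same cycle, and joins their cycles otherwise. -/
theorem sameCycle_mul_swap_iff [Finite α] (hab : a ≠ b) :
    (f * Equiv.swap a b).SameCycle a b ↔ ¬ f.SameCycle a b := by
  constructor
  · intro h' h
    classical
    -- if `f ^ k` is the first power that takes `a` to `b`, then `b` returns to itself under
    -- `f * swap a b` after `k` steps, without meeting `a`
    have hex : ∃ k, 0 < k ∧ (f ^ k) a = b := by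
      obtain ⟨k, hk⟩ := h.exists_nat_pow_eq
      refine ⟨k, Nat.pos_of_ne_zero ?_, hk⟩
      rintro rfl
      exact hab (by simpa using hk)
    set k := Nat.find hex with hkdef
    obtain ⟨hk0, hk⟩ := Nat.find_spec hex
    rw [← hkdef] at hk0 hk
    have hmin : ∀ j, 0 < j → j < k → (f ^ j) a ≠ b := fun j h0 hj e =>
      Nat.find_min hex hj ⟨h0, e⟩
    have hna : ∀ j, 0 < j → j ≤ k → (f ^ j) a ≠ a := by
      intro j h0 hj e
      rcases hj.lt_or_eq with hj | rfl
      · apply hmin (k - j) (by omega) (by omega)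
        have : (f ^ (k - j)) ((f ^ j) a) = b := by
          rw [← Equiv.Perm.mul_apply, ← pow_add, Nat.sub_add_cancel hj.le, hk]
        rwa [e] at this
      · exact hab (e.symm.trans hk)
    have hpow := @mul_swap_pow_apply _ _ f a b k
      fun j h0 hj => ⟨hna j h0 hj.le, hmin j h0 hj⟩
    obtain ⟨m, hm⟩ := h'.symm.exists_nat_pow_eq
    have hper : ((f * Equiv.swap a b) ^ k) b = b := by rw [hpow hk0 le_rfl, hk]
    have hmod : ((f * Equiv.swap a b) ^ (m % k)) b = a := by
      have hfix : (((f * Equiv.swap a b) ^ k) ^ (m / k)) b = b :=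
        Function.IsFixedPt.perm_pow (show Function.IsFixedPt _ b from hper) _
      rw [← Nat.mod_add_div m k, pow_add, Equiv.Perm.mul_apply, pow_mul, hfix] at hm
      exact hm
    rcases Nat.eq_zero_or_pos (m % k) with h0 | h0
    · rw [h0] at hmod
      exact hab (by simpa using hmod.symm)
    · have hlt := Nat.mod_lt m hk0
      rw [hpow h0 hlt.le] at hmod
      exact hna _ h0 hlt.le hmod
  · intro h
    classical
    -- the first power `f ^ k` that fixes `a` gives the number of steps from `b` to `a`
    have hex : ∃ k, 0 < k ∧ (f ^ k) a = a :=
      ⟨orderOf f, orderOf_pos f, by rw [pow_orderOf_eq_one]; rfl⟩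
    set k := Nat.find hex with hkdef
    obtain ⟨hk0, hk⟩ := Nat.find_spec hex
    rw [← hkdef] at hk0 hk
    have hpow := @mul_swap_pow_apply _ _ f a b k
      (fun j h0 hj => ⟨fun e => Nat.find_min hex hj ⟨h0, e⟩, fun e => h ⟨j, by simpa using e⟩⟩)
    exact Equiv.Perm.SameCycle.symm ⟨k, by rw [zpow_natCast, hpow hk0 le_rfl, hk]⟩

/-- The cycles of `f * swap a b` when `a` and `b` lie on different cycles of `f`: those two are
joined, the other ones stay. -/
theorem sameCycle_mul_swap_of_not_sameCycle [Finite α] (hab : ¬ f.SameCycle a b) {x y : α} :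
    (f * Equiv.swap a b).SameCycle x y ↔
      f.SameCycle x y ∨ f.SameCycle a x ∧ f.SameCycle b y ∨ f.SameCycle b x ∧ f.SameCycle a y := by
  have hne : a ≠ b := fun e => hab (e ▸ Equiv.Perm.SameCycle.refl f a)
  have hab' : (f * Equiv.swap a b).SameCycle a b := (sameCycle_mul_swap_iff hne).2 hab
  -- joined cycles absorb the old ones, since `f z = (f * swap a b) (swap a b z)`
  have hle : ∀ {x y}, f.SameCycle x y → (f * Equiv.swap a b).SameCycle x y := by
    intro x y h
    refine rel_of_sameCycle (Equiv.Perm.SameCycle.equivalence _) (fun z => ?_) h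
    have h1 : (f * Equiv.swap a b).SameCycle (Equiv.swap a b z) (f z) := by
      have := (Equiv.Perm.sameCycle_apply_right (f := f * Equiv.swap a b)).2
        (Equiv.Perm.SameCycle.refl _ (Equiv.swap a b z))
      simpa using this
    refine Equiv.Perm.SameCycle.trans ?_ h1
    rcases eq_or_ne z a with rfl | hza
    · rwa [Equiv.swap_apply_left]
    rcases eq_or_ne z b with rfl | hzb
    · rw [Equiv.swap_apply_right]; exact hab'.symm
    · rw [Equiv.swap_apply_of_ne_of_ne hza hzb]
  constructor
  · intro h
    refine rel_of_sameCycle (r := fun x y => f.SameCycle x y ∨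
      f.SameCycle a x ∧ f.SameCycle b y ∨ f.SameCycle b x ∧ f.SameCycle a y) ⟨?_, ?_, ?_⟩ ?_ h
    · exact fun x => Or.inl (Equiv.Perm.SameCycle.refl _ _)
    · rintro x y (h | h | h)
      · exact Or.inl h.symm
      · exact Or.inr (Or.inr h.symm)
      · exact Or.inr (Or.inl h.symm)
    · rintro x y z (h | ⟨h1, h2⟩ | ⟨h1, h2⟩) (h' | ⟨h3, h4⟩ | ⟨h3, h4⟩)
      · exact Or.inl (h.trans h')
      · exact Or.inr (Or.inl ⟨h3.trans h.symm, h4⟩)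
      · exact Or.inr (Or.inr ⟨h3.trans h.symm, h4⟩)
      · exact Or.inr (Or.inl ⟨h1, h2.trans h'⟩)
      · exact absurd (h3.trans h2.symm) hab
      · exact Or.inl (h1.symm.trans h4)
      · exact Or.inr (Or.inr ⟨h1, h2.trans h'⟩)
      · exact Or.inl (h1.symm.trans h4)
      · exact absurd (h2.trans h3.symm) hab
    · intro z
      rcases eq_or_ne z a with rfl | hza
      · refine Or.inr (Or.inl ⟨Equiv.Perm.SameCycle.refl _ _, ?_⟩)
        simp [Equiv.Perm.SameCycle.refl]
      rcases eq_or_ne z b with rfl | hzb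
      · refine Or.inr (Or.inr ⟨Equiv.Perm.SameCycle.refl _ _, ?_⟩)
        simp [Equiv.Perm.SameCycle.refl]
      · refine Or.inl ?_
        rw [Equiv.Perm.mul_apply, Equiv.swap_apply_of_ne_of_ne hza hzb]
        exact Equiv.Perm.sameCycle_apply_right.2 (Equiv.Perm.SameCycle.refl _ _)
  · rintro (h | ⟨h1, h2⟩ | ⟨h1, h2⟩)
    · exact hle h
    · exact (hle h1).symm.trans (hab'.trans (hle h2))
    · exact (hle h1).symm.trans (hab'.symm.trans (hle h2))

end Perm

/-! ### Cubes of permutations -/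

section Flip

variable {ι : Type*} [DecidableEq ι]

/-- The vertex of the cube that differs from `s` in the coordinate `v`. -/
def flipAt (s : ι → Bool) (v : ι) : ι → Bool := Function.update s v (!s v)

@[simp] theorem flipAt_self (s : ι → Bool) (v : ι) : flipAt s v v = !s v := by simp [flipAt]

theorem flipAt_of_ne (s : ι → Bool) {v w : ι} (h : w ≠ v) : flipAt s v w = s w := by
  simp [flipAt, h]

@[simp] theorem flipAt_flipAt (s : ι → Bool) (v : ι) : flipAt (flipAt s v) v = s := by
  simp [flipAt]

theorem flipAt_comm (s : ι → Bool) (v w : ι) :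
    flipAt (flipAt s v) w = flipAt (flipAt s w) v := by
  rcases eq_or_ne v w with rfl | h
  · rfl
  · rw [flipAt, flipAt_of_ne s h.symm, flipAt, flipAt, flipAt_of_ne s h, flipAt,
      Function.update_comm h]

end Flip

/-- Permutations of a finite set indexed by the vertices of a cube, such that crossing an edge in
the direction `v` multiplies by the transposition of `a v` and `b v`; the transpositions of
different directions are disjoint. -/
structure SwapCube (ι α : Type*) [DecidableEq ι] [DecidableEq α] where
  perm : (ι → Bool) → Equiv.Perm α
  a : ι → α
  b : ι → α
  a_ne_b : ∀ v, a v ≠ b v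
  a_ne_a : ∀ v w, v ≠ w → a v ≠ a w
  a_ne_b' : ∀ v w, v ≠ w → a v ≠ b w
  b_ne_b : ∀ v w, v ≠ w → b v ≠ b w
  perm_flipAt : ∀ s v, perm (flipAt s v) = perm s * Equiv.swap (a v) (b v)

namespace SwapCube

variable {ι α : Type*} [DecidableEq ι] [DecidableEq α] (Q : SwapCube ι α)

/-- Two points lie on the same cycle at the vertex `s`. -/
abbrev Rel (s : ι → Bool) (x y : α) : Prop := (Q.perm s).SameCycle x y

/-- The cycle through a point. -/
def cyc (s : ι → Bool) (x : α) : Set α := {y | Q.Rel s x y}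

/-- The set of cycles at a vertex. -/
def cycles (s : ι → Bool) : Set (Set α) := Set.range (Q.cyc s)

/-- Crossing the edge in the direction `v` joins two cycles. (Otherwise it splits one cycle.) -/
def Merges (s : ι → Bool) (v : ι) : Prop := ¬ Q.Rel s (Q.a v) (Q.b v)

variable {Q} {s : ι → Bool} {v w : ι} {x y : α}

theorem cyc_eq_iff : Q.cyc s x = Q.cyc s y ↔ Q.Rel s x y := by
  constructor
  · intro h
    have : y ∈ Q.cyc s y := Equiv.Perm.SameCycle.refl _ _
    rwa [← h] at this
  · intro h
    ext z
    exact ⟨fun hz => h.symm.trans hz, fun hz => h.trans hz⟩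

theorem cyc_eq_of_mem {C : Set α} (hC : C ∈ Q.cycles s) (hx : x ∈ C) : Q.cyc s x = C := by
  obtain ⟨y, rfl⟩ := hC
  exact (cyc_eq_iff.2 hx).symm

theorem mem_cyc_self : x ∈ Q.cyc s x := Equiv.Perm.SameCycle.refl _ _

theorem cyc_mem_cycles : Q.cyc s x ∈ Q.cycles s := ⟨x, rfl⟩

theorem merges_iff_cyc_ne : Q.Merges s v ↔ Q.cyc s (Q.a v) ≠ Q.cyc s (Q.b v) :=
  cyc_eq_iff.not.symm

section Finite

variable [Finite α]

theorem merges_flipAt : Q.Merges (flipAt s v) v ↔ ¬ Q.Merges s v := by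
  rw [Merges, Merges, Rel, Q.perm_flipAt, sameCycle_mul_swap_iff (Q.a_ne_b v)]

theorem rel_flipAt (h : Q.Merges s v) : Q.Rel (flipAt s v) x y ↔
    Q.Rel s x y ∨ Q.Rel s (Q.a v) x ∧ Q.Rel s (Q.b v) y ∨
      Q.Rel s (Q.b v) x ∧ Q.Rel s (Q.a v) y := by
  rw [Rel, Q.perm_flipAt, sameCycle_mul_swap_of_not_sameCycle h]

theorem rel_flipAt_a_b (h : Q.Merges s v) : Q.Rel (flipAt s v) (Q.a v) (Q.b v) := by
  by_contra h'
  exact merges_flipAt.1 h' h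

theorem cyc_flipAt_a (h : Q.Merges s v) :
    Q.cyc (flipAt s v) (Q.a v) = Q.cyc s (Q.a v) ∪ Q.cyc s (Q.b v) := by
  ext x
  simp only [cyc, Set.mem_ofPred_eq, rel_flipAt h, Set.mem_union]
  constructor
  · rintro (h' | h' | h')
    · exact Or.inl h'
    · exact Or.inr h'.2
    · exact Or.inl h'.2
  · rintro (h' | h')
    · exact Or.inl h'
    · exact Or.inr (Or.inl ⟨Equiv.Perm.SameCycle.refl _ _, h'⟩)

theorem cyc_flipAt_of_not_rel (h : Q.Merges s v) (ha : ¬ Q.Rel s (Q.a v) x)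
    (hb : ¬ Q.Rel s (Q.b v) x) : Q.cyc (flipAt s v) x = Q.cyc s x := by
  ext y
  simp only [cyc, Set.mem_ofPred_eq, rel_flipAt h]
  tauto

/-- A cycle before a merge survives the merge iff it contains neither of the two merged points. -/
theorem cyc_mem_cycles_flipAt_iff (h : Q.Merges s v) :
    Q.cyc s x ∈ Q.cycles (flipAt s v) ↔ ¬ Q.Rel s (Q.a v) x ∧ ¬ Q.Rel s (Q.b v) x := by
  constructor
  · intro hx
    have hx' : Q.cyc (flipAt s v) x = Q.cyc s x := cyc_eq_of_mem hx mem_cyc_self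
    constructor
    · intro ha
      have e1 : Q.cyc s (Q.a v) = Q.cyc s x := cyc_eq_iff.2 ha
      have e2 : Q.cyc (flipAt s v) (Q.a v) = Q.cyc (flipAt s v) x :=
        cyc_eq_iff.2 ((rel_flipAt h).2 (Or.inl ha))
      have : Q.b v ∈ Q.cyc s (Q.a v) := by
        rw [e1, ← hx', ← e2]; exact rel_flipAt_a_b h
      exact h this
    · intro hb
      have e1 : Q.cyc s (Q.b v) = Q.cyc s x := cyc_eq_iff.2 hb
      have e2 : Q.cyc (flipAt s v) (Q.b v) = Q.cyc (flipAt s v) x :=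
        cyc_eq_iff.2 ((rel_flipAt h).2 (Or.inl hb))
      have : Q.a v ∈ Q.cyc s (Q.b v) := by
        rw [e1, ← hx', ← e2]; exact (rel_flipAt_a_b h).symm
      exact h (Equiv.Perm.SameCycle.symm this)
  · rintro ⟨ha, hb⟩
    rw [← cyc_flipAt_of_not_rel h ha hb]
    exact cyc_mem_cycles

theorem cycles_eq_of_merges (h : Q.Merges s v) : Q.cycles s =
    insert (Q.cyc s (Q.a v)) (insert (Q.cyc s (Q.b v)) (Q.cycles s ∩ Q.cycles (flipAt s v))) := by
  ext C
  simp only [Set.mem_insert_iff, Set.mem_inter_iff]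
  constructor
  · rintro ⟨x, rfl⟩
    by_cases ha : Q.Rel s (Q.a v) x
    · exact Or.inl (cyc_eq_iff.2 ha.symm)
    by_cases hb : Q.Rel s (Q.b v) x
    · exact Or.inr (Or.inl (cyc_eq_iff.2 hb.symm))
    exact Or.inr (Or.inr ⟨cyc_mem_cycles, (cyc_mem_cycles_flipAt_iff h).2 ⟨ha, hb⟩⟩)
  · rintro (rfl | rfl | hC)
    · exact cyc_mem_cycles
    · exact cyc_mem_cycles
    · exact hC.1

theorem cycles_flipAt_eq_of_merges (h : Q.Merges s v) : Q.cycles (flipAt s v) =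
    insert (Q.cyc (flipAt s v) (Q.a v)) (Q.cycles s ∩ Q.cycles (flipAt s v)) := by
  ext C
  simp only [Set.mem_insert_iff, Set.mem_inter_iff]
  constructor
  · rintro ⟨x, rfl⟩
    by_cases hx : x ∈ Q.cyc (flipAt s v) (Q.a v)
    · exact Or.inl (cyc_eq_of_mem cyc_mem_cycles hx ▸ rfl)
    · refine Or.inr ⟨?_, cyc_mem_cycles⟩
      rw [cyc_flipAt_a h, Set.mem_union, not_or] at hx
      rw [cyc_flipAt_of_not_rel h hx.1 hx.2]
      exact cyc_mem_cycles
  · rintro (rfl | hC)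
    · exact cyc_mem_cycles
    · exact hC.2

theorem cyc_a_notMem (h : Q.Merges s v) : Q.cyc s (Q.a v) ∉ Q.cycles (flipAt s v) :=
  fun h' => ((cyc_mem_cycles_flipAt_iff h).1 h').1 (Equiv.Perm.SameCycle.refl _ _)

theorem cyc_b_notMem (h : Q.Merges s v) : Q.cyc s (Q.b v) ∉ Q.cycles (flipAt s v) :=
  fun h' => ((cyc_mem_cycles_flipAt_iff h).1 h').2 (Equiv.Perm.SameCycle.refl _ _)

theorem cyc_flipAt_a_notMem (h : Q.Merges s v) : Q.cyc (flipAt s v) (Q.a v) ∉ Q.cycles s := by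
  intro h'
  have : Q.cyc s (Q.a v) = Q.cyc (flipAt s v) (Q.a v) := cyc_eq_of_mem h' mem_cyc_self
  exact cyc_a_notMem h (this ▸ cyc_mem_cycles)

theorem ncard_cycles_of_merges (h : Q.Merges s v) :
    (Q.cycles s).ncard = (Q.cycles (flipAt s v)).ncard + 1 := by
  have hb : Q.cyc s (Q.b v) ∉ Q.cycles s ∩ Q.cycles (flipAt s v) :=
    fun h' => cyc_b_notMem h h'.2
  have ha : Q.cyc s (Q.a v) ∉
      insert (Q.cyc s (Q.b v)) (Q.cycles s ∩ Q.cycles (flipAt s v)) := by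
    rw [Set.mem_insert_iff, not_or]
    exact ⟨merges_iff_cyc_ne.1 h, fun h' => cyc_a_notMem h h'.2⟩
  have hab : Q.cyc (flipAt s v) (Q.a v) ∉ Q.cycles s ∩ Q.cycles (flipAt s v) :=
    fun h' => cyc_flipAt_a_notMem h h'.1
  rw [cycles_eq_of_merges h, Set.ncard_insert_of_notMem ha (Set.toFinite _),
    Set.ncard_insert_of_notMem hb (Set.toFinite _)]
  conv_rhs => rw [cycles_flipAt_eq_of_merges h, Set.ncard_insert_of_notMem hab (Set.toFinite _)]

theorem ncard_cycles_of_not_merges (h : ¬ Q.Merges s v) :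
    (Q.cycles (flipAt s v)).ncard = (Q.cycles s).ncard + 1 := by
  have := ncard_cycles_of_merges (merges_flipAt.2 h)
  rwa [flipAt_flipAt] at this

/-- Both ways around a face of the cube contain the same number of merges, as they change the number
of cycles by the same amount. -/
theorem merges_face :
    (Q.Merges s v ∧ Q.Merges (flipAt s v) w ↔ Q.Merges s w ∧ Q.Merges (flipAt s w) v) ∧
    (Q.Merges s v ∨ Q.Merges (flipAt s v) w ↔ Q.Merges s w ∨ Q.Merges (flipAt s w) v) := by
  have h1 := @ncard_cycles_of_merges _ _ _ _ Q s v _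
  have h2 := @ncard_cycles_of_not_merges _ _ _ _ Q s v _
  have h3 := @ncard_cycles_of_merges _ _ _ _ Q s w _
  have h4 := @ncard_cycles_of_not_merges _ _ _ _ Q s w _
  have h5 := @ncard_cycles_of_merges _ _ _ _ Q (flipAt s v) w _
  have h6 := @ncard_cycles_of_not_merges _ _ _ _ Q (flipAt s v) w _
  have h7 := @ncard_cycles_of_merges _ _ _ _ Q (flipAt s w) v _
  have h8 := @ncard_cycles_of_not_merges _ _ _ _ Q (flipAt s w) v _
  rw [flipAt_comm s w v] at h7 h8
  by_cases e1 : Q.Merges s v <;> by_cases e2 : Q.Merges s w <;>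
    by_cases e3 : Q.Merges (flipAt s v) w <;> by_cases e4 : Q.Merges (flipAt s w) v <;>
    simp only [e1, e2, e3, e4, not_true, not_false_iff, forall_true_left, false_imp_iff,
      and_self, or_self, and_true, true_and, or_true, or_false, and_false,
      iff_self]
      at h1 h2 h3 h4 h5 h6 h7 h8 ⊢ <;> omega

/-- Every face of the cube has a vertex at which both edges of the face are merges. -/
theorem exists_merges_merges (s : ι → Bool) (v w : ι) :
    Q.Merges s v ∧ Q.Merges s w ∨
    Q.Merges (flipAt s v) v ∧ Q.Merges (flipAt s v) w ∨
    Q.Merges (flipAt s w) v ∧ Q.Merges (flipAt s w) w ∨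
    Q.Merges (flipAt (flipAt s v) w) v ∧ Q.Merges (flipAt (flipAt s v) w) w := by
  have h := @merges_face _ _ _ _ Q s v w _
  have e4 : Q.Merges (flipAt (flipAt s v) w) v ↔ ¬ Q.Merges (flipAt s w) v := by
    rw [flipAt_comm, merges_flipAt]
  rw [e4, merges_flipAt (s := flipAt s v), merges_flipAt (s := s) (v := v),
    merges_flipAt (s := s) (v := w)]
  tauto

/-- If a face of the cube has two opposite vertices with both edges merging, then at these vertices
the two directions meet the same two cycles. -/
theorem rel_of_merges_not_merges (hv : Q.Merges s v) (hw : Q.Merges s w)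
    (h : ¬ Q.Merges (flipAt s v) w) :
    Q.Rel s (Q.a v) (Q.a w) ∧ Q.Rel s (Q.b v) (Q.b w) ∨
      Q.Rel s (Q.b v) (Q.a w) ∧ Q.Rel s (Q.a v) (Q.b w) := by
  have := not_not.1 h
  rw [rel_flipAt hv] at this
  exact this.resolve_left hw

end Finite

end SwapCube

/-! ### Orderings and exterior products -/

section Wedge

variable {α : Type*}

theorem orderSign_mul_self (r : α → ℕ) (l : List α) : orderSign r l * orderSign r l = 1 := by
  rw [orderSign, ← mul_pow]
  simp

theorem orderSign_cons (r : α → ℕ) (x : α) (l : List α) :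
    orderSign r (x :: l) = (-1) ^ l.countP (fun y => decide (r y < r x)) * orderSign r l := by
  rw [orderSign, inversions, pow_add, orderSign]

theorem orderSign_swap (r : α → ℕ) {x y : α} (h : r x ≠ r y) (l : List α) :
    orderSign r (x :: y :: l) = -orderSign r (y :: x :: l) := by
  simp only [orderSign_cons, List.countP_cons, decide_eq_true_eq]
  rcases h.lt_or_gt with h | h
  · simp only [h, h.not_gt, if_true, if_false]
    ring
  · simp only [h, h.not_gt, if_true, if_false]
    ring

/-- The indicator function of a set. -/
def ind (C : Set α) : α → ℚ := C.indicator 1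

theorem ind_of_mem {C : Set α} {x : α} (h : x ∈ C) : ind C x = 1 := by simp [ind, h]

theorem ind_of_notMem {C : Set α} {x : α} (h : x ∉ C) : ind C x = 0 := by simp [ind, h]

/-- The exterior product of the indicator functions of the sets in a list. -/
def wedge (L : List (Set α)) : ExteriorAlgebra ℚ (α → ℚ) :=
  (L.map fun C => ExteriorAlgebra.ι ℚ (ind C)).prod

theorem wedge_cons (C : Set α) (L : List (Set α)) :
    wedge (C :: L) = ExteriorAlgebra.ι ℚ (ind C) * wedge L := by simp [wedge]

/-- Contraction of the exterior algebra with a linear form. -/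
abbrev contract (u : Module.Dual ℚ (α → ℚ)) :
    ExteriorAlgebra ℚ (α → ℚ) →ₗ[ℚ] ExteriorAlgebra ℚ (α → ℚ) :=
  CliffordAlgebra.contractLeft u

theorem contract_wedge_cons (u : Module.Dual ℚ (α → ℚ)) (C : Set α) (L : List (Set α)) :
    contract u (wedge (C :: L)) =
      u (ind C) • wedge L - ExteriorAlgebra.ι ℚ (ind C) * contract u (wedge L) := by
  rw [wedge_cons]
  exact CliffordAlgebra.contractLeft_ι_mul _ _ _

theorem contract_wedge_eq_zero {u : Module.Dual ℚ (α → ℚ)} {L : List (Set α)}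
    (h : ∀ C ∈ L, u (ind C) = 0) : contract u (wedge L) = 0 := by
  induction L with
  | nil => exact CliffordAlgebra.contractLeft_one _ _
  | cons C L ih =>
    rw [contract_wedge_cons, h C (by simp), ih fun C hC => h C (by simp [hC])]
    simp

theorem wedge_swap (C D : Set α) (L : List (Set α)) :
    wedge (C :: D :: L) = -wedge (D :: C :: L) := by
  simp only [wedge_cons, ← mul_assoc]
  rw [eq_neg_iff_add_eq_zero, ← add_mul, ExteriorAlgebra.ι_add_mul_swap, zero_mul]

/-- Reordering changes the exterior product by the sign of the permutation. -/
theorem orderSign_smul_wedge_of_perm {r : Set α → ℕ} {L L' : List (Set α)} (h : L.Perm L')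
    (hr : (L.map r).Nodup) : orderSign r L • wedge L = orderSign r L' • wedge L' := by
  induction h with
  | nil => rfl
  | cons x h ih =>
    rw [orderSign_cons, orderSign_cons, h.countP_eq, wedge_cons, wedge_cons, mul_smul, mul_smul,
      ← mul_smul_comm, ih (List.Nodup.of_cons hr), mul_smul_comm]
  | swap x y l =>
    have hxy : r x ≠ r y := by
      intro e
      simp [e] at hr
    rw [orderSign_swap r hxy.symm, wedge_swap, smul_neg, neg_smul, neg_neg]
  | trans h1 h2 ih1 ih2 =>
    rw [ih1 hr, ih2 ((h1.map r).nodup_iff.1 hr)]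

/-- Indicator functions of nonempty disjoint sets are linearly independent, so that their exterior
product does not vanish. -/
theorem wedge_ne_zero {L : List (Set α)} (hne : ∀ C ∈ L, C.Nonempty)
    (hd : L.Pairwise Disjoint) : wedge L ≠ 0 := by
  induction L with
  | nil => simp [wedge]
  | cons C L ih =>
    rw [List.pairwise_cons] at hd
    obtain ⟨x, hx⟩ := hne C (by simp)
    intro h
    refine ih (fun D hD => hne D (by simp [hD])) hd.2 ?_
    have h0 := contract_wedge_cons (LinearMap.proj x) C L
    rw [h, map_zero, contract_wedge_eq_zero (L := L)] at h0
    · simpa [ind_of_mem hx] using h0.symm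
    · intro D hD
      exact ind_of_notMem fun hxD => (Set.disjoint_left.1 (hd.1 D hD)) hx hxD

theorem ind_union {C D : Set α} (h : Disjoint C D) : ind (C ∪ D) = ind C + ind D :=
  Set.indicator_union_of_disjoint h _

theorem contract_wedge_pair {u : Module.Dual ℚ (α → ℚ)} {C D : Set α} {L : List (Set α)} {ε : ℚ}
    (hCD : Disjoint C D) (hC : u (ind C) = ε) (hD : u (ind D) = -ε)
    (hL : ∀ E ∈ L, u (ind E) = 0) :
    contract u (wedge (C :: D :: L)) = ε • wedge ((C ∪ D) :: L) := by
  rw [contract_wedge_cons, contract_wedge_cons, contract_wedge_eq_zero hL, hC, hD, mul_zero,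
    sub_zero, wedge_cons, wedge_cons, ind_union hCD, map_add, add_mul, smul_add, mul_smul_comm,
    neg_smul, sub_neg_eq_add, add_comm]

end Wedge

namespace SwapCube

variable {ι α : Type*} [DecidableEq ι] [DecidableEq α] (Q : SwapCube ι α) [Finite α]

/-! ### The sign of an edge of the cube -/

/-- The cycles common to two vertices, listed in some order. -/
def common (s t : ι → Bool) : List (Set α) :=
  (Set.toFinite (Q.cycles s ∩ Q.cycles t)).toFinset.toList

/-- The linear form whose contraction joins the cycles through `a v` and `b v`. -/
def form (v : ι) : Module.Dual ℚ (α → ℚ) :=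
  (LinearMap.proj (Q.a v) : (α → ℚ) →ₗ[ℚ] ℚ) - (LinearMap.proj (Q.b v) : (α → ℚ) →ₗ[ℚ] ℚ)

omit [Finite α] in
theorem form_apply (v : ι) (f : α → ℚ) : Q.form v f = f (Q.a v) - f (Q.b v) := rfl

variable (ord : (ι → Bool) → Set α → ℕ)

/-- The exterior product of the indicator functions of all cycles at `s`, in the order given by
`ord s`. -/
def vol (s : ι → Bool) : ExteriorAlgebra ℚ (α → ℚ) :=
  orderSign (ord s) (Set.toFinite (Q.cycles s)).toFinset.toList •
    wedge (Set.toFinite (Q.cycles s)).toFinset.toList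

open Classical in
/-- The sign with which `x_a ∧ x_b ∧ ⋯ ↦ x ∧ ⋯` (or, at a splitting edge, `x ∧ ⋯ ↦ x_a ∧ x_b ∧ ⋯`)
acts between the ordered products of the cycles at the two ends of an edge. -/
def edgeSign (s : ι → Bool) (v : ι) : ℤ :=
  if Q.Merges s v then
    orderSign (ord s) (Q.cyc s (Q.a v) :: Q.cyc s (Q.b v) :: Q.common s (flipAt s v)) *
      orderSign (ord (flipAt s v)) (Q.cyc (flipAt s v) (Q.a v) :: Q.common s (flipAt s v))
  else
    orderSign (ord (flipAt s v)) (Q.cyc (flipAt s v) (Q.a v) :: Q.cyc (flipAt s v) (Q.b v) ::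
      Q.common s (flipAt s v)) *
      orderSign (ord s) (Q.cyc s (Q.a v) :: Q.common s (flipAt s v))

variable {Q ord} {s t : ι → Bool} {v w : ι} {x y : α}

theorem mem_common {C : Set α} : C ∈ Q.common s t ↔ C ∈ Q.cycles s ∧ C ∈ Q.cycles t := by
  simp [common]

theorem nodup_common : (Q.common s t).Nodup := Finset.nodup_toList _

omit [Finite α] in
theorem disjoint_of_mem_cycles {C D : Set α} (hC : C ∈ Q.cycles s) (hD : D ∈ Q.cycles s)
    (h : C ≠ D) : Disjoint C D := by
  rw [Set.disjoint_left]
  intro x hxC hxD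
  exact h ((cyc_eq_of_mem hC hxC).symm.trans (cyc_eq_of_mem hD hxD))

/-- The volume does not depend on the list that enumerates the cycles. -/
theorem vol_eq (hord : ∀ s, Set.InjOn (ord s) (Q.cycles s)) {L : List (Set α)} (hL : L.Nodup)
    (h : ∀ C, C ∈ L ↔ C ∈ Q.cycles s) : Q.vol ord s = orderSign (ord s) L • wedge L := by
  refine orderSign_smul_wedge_of_perm ?_ ?_
  · rw [List.perm_ext_iff_of_nodup (Finset.nodup_toList _) hL]
    simp [h]
  · refine (List.nodup_map_iff_inj_on (Finset.nodup_toList _)).2 fun C hC D hD e => ?_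
    exact hord s (by simpa using hC) (by simpa using hD) e

theorem vol_ne_zero : Q.vol ord s ≠ 0 := by
  have h : wedge (Set.toFinite (Q.cycles s)).toFinset.toList ≠ 0 := by
    refine wedge_ne_zero ?_ ?_
    · intro C hC
      obtain ⟨x, rfl⟩ : C ∈ Q.cycles s := by simpa using hC
      exact ⟨x, mem_cyc_self⟩
    · refine List.Pairwise.imp_of_mem ?_ (Finset.nodup_toList _)
      intro C D hC hD hne
      exact disjoint_of_mem_cycles (by simpa using hC) (by simpa using hD) hne
  intro h0
  apply h
  have h1 := congrArg
    (fun z => orderSign (ord s) (Set.toFinite (Q.cycles s)).toFinset.toList • z) h0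
  simpa only [vol, smul_smul, orderSign_mul_self, one_smul, smul_zero] using h1

theorem smul_vol_inj {m n : ℤ} (h : m • Q.vol ord s = n • Q.vol ord s) : m = n := by
  rw [← Int.cast_smul_eq_zsmul ℚ, ← Int.cast_smul_eq_zsmul ℚ] at h
  exact_mod_cast smul_left_injective ℚ (vol_ne_zero (Q := Q) (ord := ord) (s := s)) h

theorem edgeSign_mul_self : Q.edgeSign ord s v * Q.edgeSign ord s v = 1 := by
  rw [edgeSign]
  split_ifs <;> rw [mul_mul_mul_comm, orderSign_mul_self, orderSign_mul_self, one_mul]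

variable (hord : ∀ s, Set.InjOn (ord s) (Q.cycles s))

include hord in
theorem vol_eq_before (h : Q.Merges s v) {L : List (Set α)} (hL : L.Nodup)
    (hmem : ∀ C, C ∈ L ↔ C ∈ Q.cycles s ∧ C ∈ Q.cycles (flipAt s v)) :
    Q.vol ord s = orderSign (ord s) (Q.cyc s (Q.a v) :: Q.cyc s (Q.b v) :: L) •
      wedge (Q.cyc s (Q.a v) :: Q.cyc s (Q.b v) :: L) := by
  refine vol_eq hord ?_ fun C => ?_
  · simp only [List.nodup_cons, List.mem_cons, not_or, hmem, hL, and_true]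
    exact ⟨⟨merges_iff_cyc_ne.1 h, fun h' => cyc_a_notMem h h'.2⟩,
      fun h' => cyc_b_notMem h h'.2⟩
  · conv_rhs => rw [cycles_eq_of_merges h]
    simp [hmem]

include hord in
theorem vol_eq_after (h : Q.Merges s v) {L : List (Set α)} (hL : L.Nodup)
    (hmem : ∀ C, C ∈ L ↔ C ∈ Q.cycles s ∧ C ∈ Q.cycles (flipAt s v)) :
    Q.vol ord (flipAt s v) = orderSign (ord (flipAt s v)) (Q.cyc (flipAt s v) (Q.a v) :: L) •
      wedge (Q.cyc (flipAt s v) (Q.a v) :: L) := by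
  refine vol_eq hord ?_ fun C => ?_
  · simp only [List.nodup_cons, hmem, hL, and_true]
    exact fun h' => cyc_flipAt_a_notMem h h'.1
  · conv_rhs => rw [cycles_flipAt_eq_of_merges h]
    simp [hmem]

/-- A linear form `p ↦ f p - f q` on indicator functions of cycles other than those of `a v` and
`b v` vanishes if `p` and `q` lie on the latter. -/
theorem form_eq_zero_of_mem_common (hw : ∀ p, p = Q.a w ∨ p = Q.b w →
    p ∈ Q.cyc s (Q.a v) ∨ p ∈ Q.cyc s (Q.b v)) (h : Q.Merges s v) {C : Set α}
    (hC : C ∈ Q.cycles s ∧ C ∈ Q.cycles (flipAt s v)) : Q.form w (ind C) = 0 := by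
  have key : ∀ p, p = Q.a w ∨ p = Q.b w → p ∉ C := by
    intro p hp hpC
    rcases hw p hp with h' | h'
    · rw [← cyc_eq_of_mem hC.1 hpC, ← cyc_eq_iff.2 h'] at hC
      exact cyc_a_notMem h hC.2
    · rw [← cyc_eq_of_mem hC.1 hpC, ← cyc_eq_iff.2 h'] at hC
      exact cyc_b_notMem h hC.2
  rw [form_apply, ind_of_notMem (key _ (Or.inl rfl)), ind_of_notMem (key _ (Or.inr rfl)), sub_zero]

include hord in
/-- Contraction with the form of a merging edge is the map of ordered products along this edge. -/
theorem contract_vol (h : Q.Merges s v) {L : List (Set α)} (hL : L.Nodup)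
    (hmem : ∀ C, C ∈ L ↔ C ∈ Q.cycles s ∧ C ∈ Q.cycles (flipAt s v)) :
    contract (Q.form v) (Q.vol ord s) =
      (orderSign (ord s) (Q.cyc s (Q.a v) :: Q.cyc s (Q.b v) :: L) *
        orderSign (ord (flipAt s v)) (Q.cyc (flipAt s v) (Q.a v) :: L)) •
        Q.vol ord (flipAt s v) := by
  have hne := merges_iff_cyc_ne.1 h
  have hdis := disjoint_of_mem_cycles cyc_mem_cycles cyc_mem_cycles hne
  have hba : Q.b v ∉ Q.cyc s (Q.a v) := h
  have hab : Q.a v ∉ Q.cyc s (Q.b v) := fun h' => h (Equiv.Perm.SameCycle.symm h')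
  rw [vol_eq_before hord h hL hmem, vol_eq_after hord h hL hmem, smul_smul, mul_assoc,
    orderSign_mul_self, mul_one, map_zsmul, contract_wedge_pair (ε := 1) hdis, one_smul,
    cyc_flipAt_a h]
  · rw [form_apply, ind_of_mem mem_cyc_self, ind_of_notMem hba, sub_zero]
  · rw [form_apply, ind_of_mem mem_cyc_self, ind_of_notMem hab, zero_sub]
  · intro C hC
    refine form_eq_zero_of_mem_common ?_ h ((hmem C).1 hC)
    rintro p (rfl | rfl)
    · exact Or.inl mem_cyc_self
    · exact Or.inr mem_cyc_self

include hord in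
theorem contract_vol_of_merges (h : Q.Merges s v) :
    contract (Q.form v) (Q.vol ord s) = Q.edgeSign ord s v • Q.vol ord (flipAt s v) := by
  rw [edgeSign, if_pos h, contract_vol hord h nodup_common fun C => mem_common]

include hord in
theorem contract_vol_of_not_merges (h : ¬ Q.Merges s v) :
    contract (Q.form v) (Q.vol ord (flipAt s v)) = Q.edgeSign ord s v • Q.vol ord s := by
  have h' := merges_flipAt.2 h
  have := contract_vol hord h' (L := Q.common s (flipAt s v)) nodup_common fun C => by
    rw [mem_common, flipAt_flipAt, and_comm]
  rw [edgeSign, if_neg h, this, flipAt_flipAt]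

include hord in
theorem edgeSign_flipAt : Q.edgeSign ord (flipAt s v) v = Q.edgeSign ord s v := by
  by_cases h : Q.Merges s v
  · have h' : ¬ Q.Merges (flipAt s v) v := fun e => merges_flipAt.1 e h
    have h1 := contract_vol_of_not_merges hord h'
    rw [flipAt_flipAt, contract_vol_of_merges hord h] at h1
    exact (smul_vol_inj h1).symm
  · have h1 := contract_vol_of_merges hord (merges_flipAt.2 h)
    rw [flipAt_flipAt, contract_vol_of_not_merges hord h] at h1
    exact (smul_vol_inj h1).symm

/-- Suppose that `g` is invariant under `f`, that `g'` is invariant under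
`f * swap a b * swap c d`, and that both separate `a` from `b` in the same way. Then they separate
`c` from `d` in opposite ways. This is where the cyclic order of the points matters. -/
theorem separate_opposite {f : Equiv.Perm α} {a b c d : α} (hab : a ≠ b) (hcd : c ≠ d)
    (hac : a ≠ c) (had : a ≠ d) (hbc : b ≠ c) (hbd : b ≠ d) {g g' : α → ℚ}
    (hg : ∀ x, g (f x) = g x) (hg' : ∀ x, g' (f (Equiv.swap a b (Equiv.swap c d x))) = g' x)
    (ha : g a = 1) (hb : g b = 0) (ha' : g' a = 1) (hb' : g' b = 0) :
    (g c - g d) * (g' c - g' d) = -1 := by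
  cases nonempty_fintype α
  -- in the invariance of `∑ x, g x * g' x` under `f`, only the terms at `a`, `b`, `c`, `d` survive
  have hsum : ∑ x, g (f x) * g' (f x) = ∑ x, g x * g' x :=
    Equiv.sum_comp f fun x => g x * g' x
  have hf' : ∀ x, g' (f x) = g' (Equiv.swap c d (Equiv.swap a b x)) := by
    intro x
    rw [← hg' (Equiv.swap c d (Equiv.swap a b x))]
    simp
  simp only [hg, hf'] at hsum
  rw [← sub_eq_zero, ← Finset.sum_sub_distrib,
    ← Finset.sum_subset (Finset.subset_univ {a, b, c, d})] at hsum
  · rw [Finset.sum_insert (by simp [hab, hac, had]), Finset.sum_insert (by simp [hbc, hbd]),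
      Finset.sum_insert (by simp [hcd]), Finset.sum_singleton] at hsum
    simp only [Equiv.swap_apply_left, Equiv.swap_apply_right,
      ha, hb, ha', hb',
      Equiv.swap_apply_of_ne_of_ne hac had, Equiv.swap_apply_of_ne_of_ne hbc hbd,
      Equiv.swap_apply_of_ne_of_ne hac.symm hbc.symm,
      Equiv.swap_apply_of_ne_of_ne had.symm hbd.symm] at hsum
    linarith
  · intro x _ hx
    simp only [Finset.mem_insert, Finset.mem_singleton, not_or] at hx
    rw [Equiv.swap_apply_of_ne_of_ne hx.1 hx.2.1, Equiv.swap_apply_of_ne_of_ne hx.2.2.1 hx.2.2.2,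
      sub_self]

omit [Finite α] in
theorem ind_cyc_perm_apply (C : Set α) (hC : C ∈ Q.cycles s) (x : α) :
    ind C (Q.perm s x) = ind C x := by
  obtain ⟨y, rfl⟩ := hC
  have : Q.perm s x ∈ Q.cyc s y ↔ x ∈ Q.cyc s y := Equiv.Perm.sameCycle_apply_right
  by_cases hx : x ∈ Q.cyc s y
  · rw [ind_of_mem hx, ind_of_mem (this.2 hx)]
  · rw [ind_of_notMem hx, ind_of_notMem (mt this.1 hx)]

include hord in
/-- If the directions `v` and `w` join the same two cycles at `s`, then the corresponding
contractions agree up to the sign that tells whether `a w` lies on the cycle of `a v` or of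
`b v`. -/
theorem contract_form_eq (hv : Q.Merges s v) (hw : Q.Merges s w) (h : ¬ Q.Merges (flipAt s v) w) :
    contract (Q.form w) (Q.vol ord s) =
      Q.form w (ind (Q.cyc s (Q.a v))) • contract (Q.form v) (Q.vol ord s) := by
  have hne := merges_iff_cyc_ne.1 hv
  have hdis := disjoint_of_mem_cycles cyc_mem_cycles cyc_mem_cycles hne
  have hba : Q.b v ∉ Q.cyc s (Q.a v) := hv
  have hab : Q.a v ∉ Q.cyc s (Q.b v) := fun h' => hv (Equiv.Perm.SameCycle.symm h')
  have hrel := rel_of_merges_not_merges hv hw h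
  have hsum : Q.form w (ind (Q.cyc s (Q.b v))) = -Q.form w (ind (Q.cyc s (Q.a v))) := by
    rw [Set.disjoint_left] at hdis
    rcases hrel with ⟨h1, h2⟩ | ⟨h1, h2⟩
    · have h1' : Q.a w ∉ Q.cyc s (Q.b v) := hdis h1
      have h2' : Q.b w ∉ Q.cyc s (Q.a v) := fun h3 => hdis h3 h2
      rw [form_apply, form_apply, ind_of_mem (C := Q.cyc s (Q.a v)) h1,
        ind_of_mem (C := Q.cyc s (Q.b v)) h2, ind_of_notMem h1', ind_of_notMem h2']
      norm_num
    · have h1' : Q.a w ∉ Q.cyc s (Q.a v) := fun h3 => hdis h3 h1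
      have h2' : Q.b w ∉ Q.cyc s (Q.b v) := hdis h2
      rw [form_apply, form_apply, ind_of_mem (C := Q.cyc s (Q.b v)) h1,
        ind_of_mem (C := Q.cyc s (Q.a v)) h2, ind_of_notMem h1', ind_of_notMem h2']
      norm_num
  have hpts : ∀ p, p = Q.a w ∨ p = Q.b w → p ∈ Q.cyc s (Q.a v) ∨ p ∈ Q.cyc s (Q.b v) := by
    rintro p (rfl | rfl)
    · exact hrel.imp And.left And.left
    · exact hrel.symm.imp And.right And.right
  have hpts' : ∀ p, p = Q.a v ∨ p = Q.b v → p ∈ Q.cyc s (Q.a v) ∨ p ∈ Q.cyc s (Q.b v) := by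
    rintro p (rfl | rfl)
    · exact Or.inl mem_cyc_self
    · exact Or.inr mem_cyc_self
  rw [vol_eq_before hord hv nodup_common fun C => mem_common, map_zsmul, map_zsmul,
    contract_wedge_pair hdis rfl hsum fun C hC =>
      form_eq_zero_of_mem_common hpts hv (mem_common.1 hC),
    contract_wedge_pair (u := Q.form v) (ε := 1) hdis _ _ fun C hC =>
      form_eq_zero_of_mem_common hpts' hv (mem_common.1 hC), one_smul, smul_comm]
  · rw [form_apply, ind_of_mem mem_cyc_self, ind_of_notMem hba, sub_zero]
  · rw [form_apply, ind_of_mem mem_cyc_self, ind_of_notMem hab, zero_sub]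

include hord in
/-- The sign of a face, seen from a vertex at which both edges are merges. -/
theorem edgeSign_face_of_merges (hvw : v ≠ w) (hv : Q.Merges s v) (hw : Q.Merges s w) :
    Q.edgeSign ord s v * Q.edgeSign ord (flipAt s v) w *
      (Q.edgeSign ord s w * Q.edgeSign ord (flipAt s w) v) = -1 := by
  set t := flipAt (flipAt s v) w with ht
  have ht' : t = flipAt (flipAt s w) v := flipAt_comm s v w
  have hface := (@merges_face _ _ _ _ Q s v w _).1
  have hcomm := CliffordAlgebra.contractLeft_comm (Q := (0 : QuadraticForm ℚ (α → ℚ)))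
    (d := Q.form w) (d' := Q.form v) (Q.vol ord s)
  have e1 : contract (Q.form v) (Q.vol ord s) = Q.edgeSign ord s v • Q.vol ord (flipAt s v) :=
    contract_vol_of_merges hord hv
  have e2 : contract (Q.form w) (Q.vol ord s) = Q.edgeSign ord s w • Q.vol ord (flipAt s w) :=
    contract_vol_of_merges hord hw
  have q1 := @edgeSign_mul_self _ _ _ _ Q _ ord s v
  have q2 := @edgeSign_mul_self _ _ _ _ Q _ ord s w
  have q3 := @edgeSign_mul_self _ _ _ _ Q _ ord (flipAt s w) v
  by_cases h : Q.Merges (flipAt s v) w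
  -- four merges: the two contractions anticommute
  · have h' := (hface.1 ⟨hv, h⟩).2
    have e3 := contract_vol_of_merges hord h
    have e4 := contract_vol_of_merges hord h'
    rw [← ht'] at e4
    rw [← ht] at e3
    have k := hcomm
    change contract (Q.form w) (contract (Q.form v) _) =
      -contract (Q.form v) (contract (Q.form w) _) at k
    rw [e1, e2, map_zsmul, map_zsmul, e3, e4, smul_smul, smul_smul, ← neg_smul] at k
    rw [smul_vol_inj k]
    linear_combination (-1 : ℤ) * q2 * (Q.edgeSign ord (flipAt s w) v) ^ 2 - q3
  -- two circles are merged, in two ways, and split again: at both `s` and `t` the contractions for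
  -- `v` and `w` are proportional, with opposite signs
  · have h' : ¬ Q.Merges (flipAt s w) v := fun e => h (hface.2 ⟨hw, e⟩).2
    have hs := contract_form_eq hord hv hw h
    have htw : Q.Merges t w := merges_flipAt.2 h
    have htv : Q.Merges t v := by rw [ht']; exact merges_flipAt.2 h'
    have htvw : ¬ Q.Merges (flipAt t v) w := by
      rw [ht', flipAt_flipAt]
      exact fun e => merges_flipAt.1 e hw
    have ht2 := contract_form_eq hord htv htw htvw
    have e3 : contract (Q.form w) (Q.vol ord t) = _ := contract_vol_of_not_merges hord h
    have e4 : contract (Q.form v) (Q.vol ord t) = _ :=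
      ht' ▸ contract_vol_of_not_merges hord h'
    rw [e1, e2] at hs
    rw [e3, e4] at ht2
    have hsep : Q.form w (ind (Q.cyc s (Q.a v))) * Q.form w (ind (Q.cyc t (Q.a v))) = -1 := by
      refine separate_opposite (f := Q.perm s) (Q.a_ne_b v) (Q.a_ne_b w) (Q.a_ne_a v w hvw)
        (Q.a_ne_b' v w hvw) (Q.a_ne_b' w v hvw.symm).symm (Q.b_ne_b v w hvw)
        (ind_cyc_perm_apply _ cyc_mem_cycles) (fun x => ?_) (ind_of_mem mem_cyc_self)
        (ind_of_notMem hv) (ind_of_mem mem_cyc_self) (ind_of_notMem htv)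
      rw [← ind_cyc_perm_apply _ (cyc_mem_cycles (s := t)) x, ht, Q.perm_flipAt, Q.perm_flipAt]
      rfl
    set p := Q.form w (ind (Q.cyc s (Q.a v)))
    set p' := Q.form w (ind (Q.cyc t (Q.a v)))
    have key : (Q.edgeSign ord s w * Q.edgeSign ord (flipAt s v) w) • Q.vol ord (flipAt s w) =
        (-(Q.edgeSign ord s v * Q.edgeSign ord (flipAt s w) v)) • Q.vol ord (flipAt s w) := by
      rw [mul_comm, mul_smul, hs, smul_comm, smul_comm _ (Q.edgeSign ord s v), ht2,
        smul_comm (Q.edgeSign ord s v) p', smul_smul p, hsep, smul_smul (Q.edgeSign ord s v)]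
      simp
    have := smul_vol_inj key
    linear_combination (Q.edgeSign ord s v * Q.edgeSign ord (flipAt s w) v) * this -
      q1 * (Q.edgeSign ord (flipAt s w) v) ^ 2 - q3

include hord in
/-- Around every face of the cube the maps of ordered products anticommute. -/
theorem edgeSign_face (s : ι → Bool) (hvw : v ≠ w) :
    Q.edgeSign ord s v * Q.edgeSign ord (flipAt s v) w *
      (Q.edgeSign ord s w * Q.edgeSign ord (flipAt s w) v) = -1 := by
  have f : ∀ s v, Q.edgeSign ord (flipAt s v) v = Q.edgeSign ord s v :=
    fun s v => edgeSign_flipAt hord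
  have e : Q.edgeSign ord (flipAt (flipAt s v) w) v = Q.edgeSign ord (flipAt s w) v := by
    rw [flipAt_comm, f]
  rcases exists_merges_merges (Q := Q) s v w with h | h | h | h
  · exact edgeSign_face_of_merges hord hvw h.1 h.2
  · have := edgeSign_face_of_merges hord hvw h.1 h.2
    rw [flipAt_flipAt, f, e] at this
    linarith
  · have := edgeSign_face_of_merges hord hvw h.1 h.2
    rw [flipAt_flipAt, f, flipAt_comm s w v, f] at this
    linarith
  · have := edgeSign_face_of_merges hord hvw h.1 h.2
    rw [flipAt_flipAt, e, f, f, flipAt_comm s v w, flipAt_flipAt, f] at this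
    linarith

end SwapCube

/-! ### Signs on the edges of a cube -/

/-- A sign on the edges of a cube whose product around every face is `1` is a coboundary. -/
theorem exists_coboundary {ι : Type*} [DecidableEq ι] [Fintype ι] {g : (ι → Bool) → ι → ℤ}
    (hg : ∀ s v, g s v * g s v = 1) (hflip : ∀ s v, g (flipAt s v) v = g s v)
    (hface : ∀ s v w, v ≠ w →
      g s v * g (flipAt s v) w * (g s w * g (flipAt s w) v) = 1) :
    ∃ τ : (ι → Bool) → ℤ, (∀ s, τ s * τ s = 1) ∧ ∀ s v, g s v = τ s * τ (flipAt s v) := by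
  suffices H : ∀ S : Finset ι, ∃ τ : (ι → Bool) → ℤ, (∀ s, τ s * τ s = 1) ∧
      ∀ s, ∀ v ∈ S, g s v = τ s * τ (flipAt s v) by
    obtain ⟨τ, h1, h2⟩ := H Finset.univ
    exact ⟨τ, h1, fun s v => h2 s v (Finset.mem_univ v)⟩
  intro S
  induction S using Finset.induction_on with
  | empty => exact ⟨fun _ => 1, by simp⟩
  | insert u S hu ih =>
    -- keep `τ` on the side `s u = 0` and transport it along the edges in the direction `u`
    obtain ⟨τ, h1, h2⟩ := ih
    refine ⟨fun s => if s u then τ (flipAt s u) * g s u else τ s, fun s => ?_, fun s v hv => ?_⟩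
    · dsimp only
      split_ifs
      · rw [mul_mul_mul_comm, h1, hg, one_mul]
      · exact h1 s
    · rcases Finset.mem_insert.1 hv with rfl | hv
      · cases hs : s v
        · simp only [hs, flipAt_self, Bool.not_false, flipAt_flipAt, hflip, if_true,
            Bool.false_eq_true, if_false]
          rw [← mul_assoc, h1, one_mul]
        · simp only [hs, flipAt_self, Bool.not_true, if_true, Bool.false_eq_true, if_false]
          linear_combination (-g s v) * h1 (flipAt s v)
      · have huv : u ≠ v := fun e => hu (e ▸ hv)
        cases hs : s u
        · simp only [hs, flipAt_of_ne s huv, Bool.false_eq_true, if_false]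
          exact h2 s v hv
        · simp only [hs, flipAt_of_ne s huv, if_true]
          have e1 := h2 (flipAt s u) v hv
          rw [flipAt_comm s u v] at e1
          have e2 := hface s v u huv.symm
          have q1 := hg s v
          have e3 : τ (flipAt s u) * g s u * (τ (flipAt (flipAt s v) u) * g (flipAt s v) u) =
              g (flipAt s u) v * g s u * g (flipAt s v) u := by rw [e1]; ring
          rw [e3]
          linear_combination (-g s v) * e2 + (g (flipAt s v) u * g s u * g (flipAt s u) v) * q1

/-! ### Source-sink structures -/

/-- A source-sink structure: an orientation of the branches (`out h` means that the half-edge `h` is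
directed away from its crossing) for which incoming and outgoing half-edges alternate around every
classical crossing. Such an orientation restricts to all circles of all states. -/
structure SourceSink (K : VirtualDiagram) where
  out : HalfEdge K.n K.m → Bool
  out_edge : ∀ h, out (K.edge h) = !out h
  out_ccw : ∀ v c, out (Sum.inl v, Corner.ccw c) = !out (Sum.inl v, c)
  out_straight : ∀ w c, out (Sum.inr w, Corner.straight c) = !out (Sum.inr w, c)

/-- An orientation of the atom, restricted to the black sides of the half-edges, is a source-sink
structure. -/
theorem nonempty_sourceSink {K : VirtualDiagram} (hK : K.atom.IsOrientable) :
    Nonempty (SourceSink K) := by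
  obtain ⟨c, hc⟩ := hK
  have h0 : ∀ h k, c (K.edge h, k) = !c (h, k) := fun h k => (hc (h, k)).1
  have h1 : ∀ h k, c (K.angle k h, k) = !c (h, k) := fun h k => (hc (h, k)).2.1
  have h2 : ∀ h, c (h, false) = !c (h, true) := fun h => (hc (h, true)).2.2
  have h3 : ∀ h k, c (K.angle k h, true) = !c (h, true) := by
    intro h k
    cases k
    · have := h1 h false
      rw [h2, h2] at this
      simpa using this
    · exact h1 h true
  refine ⟨⟨fun h => c (h, true), fun h => h0 h true, fun v x => ?_,
    fun w x => h1 (Sum.inr w, x) true⟩⟩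
  -- every two adjacent corners form a black or a white angle
  have hang : ∃ k, Corner.angle (K.positive v) k x = x.ccw :=
    ⟨x.isOver (K.positive v), by simp [Corner.angle]⟩
  obtain ⟨k, hk⟩ := hang
  have := h3 (Sum.inl v, x) k
  simpa only [VirtualDiagram.angle, hk] using this

namespace SourceSink

variable {K : VirtualDiagram} (S : SourceSink K)

theorem out_corner (v : Fin K.n) : S.out (Sum.inl v, Corner.sw) = !S.out (Sum.inl v, Corner.nw) ∧
    S.out (Sum.inl v, Corner.ne) = !S.out (Sum.inl v, Corner.nw) ∧
    S.out (Sum.inl v, Corner.se) = S.out (Sum.inl v, Corner.nw) := by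
  have h1 := S.out_ccw v Corner.nw
  have h2 := S.out_ccw v Corner.ne
  have h3 := S.out_ccw v Corner.sw
  simp only [Corner.ccw] at h1 h2 h3
  simp [h1, h2, h3]

theorem out_arc (s : K.State) (h : HalfEdge K.n K.m) : S.out (K.arc s h) = !S.out h := by
  obtain ⟨v | w, c⟩ := h
  · obtain ⟨h1, h2, h3⟩ := S.out_corner v
    simp only [VirtualDiagram.arc]
    cases K.positive v <;> cases s v <;> cases c <;>
      simp [Corner.smoothing, Corner.vertical, Corner.horizontal, h1, h2, h3]
  · exact S.out_straight w c

/-- The permutation that moves every half-edge to the next one along its circle, in the direction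
of the source-sink structure. -/
def next (s : K.State) : Equiv.Perm K.Point where
  toFun := Sum.map (fun h => if S.out h then K.edge h else K.arc s h) id
  invFun := Sum.map (fun h => if S.out h then K.arc s h else K.edge h) id
  left_inv x := by
    rcases x with h | l
    · cases hh : S.out h <;> simp [hh, S.out_edge, S.out_arc, K.edge_invol, K.arc_arc]
    · rfl
  right_inv x := by
    rcases x with h | l
    · cases hh : S.out h <;> simp [hh, S.out_edge, S.out_arc, K.edge_invol, K.arc_arc]
    · rfl

theorem next_inl (s : K.State) (h : HalfEdge K.n K.m) :
    S.next s (Sum.inl h) = Sum.inl (if S.out h then K.edge h else K.arc s h) := rfl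

/-- The incoming corner at `v` that lies on the left or upper arc of the `A`-smoothing. -/
def cornerA (v : Fin K.n) : Corner :=
  if S.out (Sum.inl v, Corner.nw) then Corner.smoothing (K.positive v) false Corner.nw
  else Corner.nw

theorem out_cornerA (v : Fin K.n) : S.out (Sum.inl v, S.cornerA v) = false := by
  obtain ⟨h1, h2, h3⟩ := S.out_corner v
  rw [cornerA]
  cases hn : S.out (Sum.inl v, Corner.nw)
  · simpa using hn
  · cases hp : K.positive v <;>
      simp [Corner.smoothing, Corner.vertical, Corner.horizontal, h1, h2, hn]

theorem out_cornerA_straight (v : Fin K.n) :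
    S.out (Sum.inl v, (S.cornerA v).straight) = false := by
  have h := S.out_cornerA v
  obtain ⟨h1, h2, h3⟩ := S.out_corner v
  generalize S.cornerA v = c at h ⊢
  cases c <;> simp_all [Corner.straight]

theorem eq_cornerA_or (v : Fin K.n) {c : Corner} (h : S.out (Sum.inl v, c) = false) :
    c = S.cornerA v ∨ c = (S.cornerA v).straight := by
  have h' := S.out_cornerA v
  obtain ⟨h1, h2, h3⟩ := S.out_corner v
  generalize S.cornerA v = d at h' ⊢
  cases c <;> cases d <;> simp_all [Corner.straight]

theorem smoothing_straight (p b : Bool) (c : Corner) :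
    Corner.smoothing p b c.straight = (Corner.smoothing p b c).straight := by
  cases p <;> cases b <;> cases c <;> rfl

theorem smoothing_not (p b : Bool) (c : Corner) :
    Corner.smoothing p (!b) c = Corner.smoothing p b c.straight := by
  cases p <;> cases b <;> cases c <;> rfl

theorem straight_straight (c : Corner) : c.straight.straight = c := by cases c <;> rfl

theorem straight_ne (c : Corner) : c ≠ c.straight := by cases c <;> simp [Corner.straight]

/-- The states of a diagram with a source-sink structure as a cube of permutations: a change of the
smoothing at `v` exchanges the continuations of the two incoming half-edges at `v`. -/
def cube : SwapCube (Fin K.n) K.Point where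
  perm := S.next
  a v := Sum.inl (Sum.inl v, S.cornerA v)
  b v := Sum.inl (Sum.inl v, (S.cornerA v).straight)
  a_ne_b v := by simpa using straight_ne (S.cornerA v)
  a_ne_a v w h := by simp [h]
  a_ne_b' v w h := by simp [h]
  b_ne_b v w h := by simp [h]
  perm_flipAt s v := by
    ext1 x
    rw [Equiv.Perm.mul_apply]
    by_cases ha : x = Sum.inl (Sum.inl v, S.cornerA v)
    · subst ha
      rw [Equiv.swap_apply_left, next_inl, next_inl, S.out_cornerA, S.out_cornerA_straight]
      simp [VirtualDiagram.arc, smoothing_not]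
    by_cases hb : x = Sum.inl (Sum.inl v, (S.cornerA v).straight)
    · subst hb
      rw [Equiv.swap_apply_right, next_inl, next_inl, S.out_cornerA, S.out_cornerA_straight]
      simp [VirtualDiagram.arc, smoothing_not, straight_straight]
    rw [Equiv.swap_apply_of_ne_of_ne ha hb]
    rcases x with ⟨w | w, c⟩ | l
    · rw [next_inl, next_inl]
      cases ho : S.out (Sum.inl w, c)
      · rcases eq_or_ne w v with rfl | hwv
        · rcases S.eq_cornerA_or w ho with rfl | rfl
          · exact absurd rfl ha
          · exact absurd rfl hb
        · simp [VirtualDiagram.arc, flipAt_of_ne s hwv]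
      · simp
    · rfl
    · rfl

/-- The circles of a state are the cycles of the permutation. -/
theorem circleOf_eq_cyc (s : K.State) (x : K.Point) : K.circleOf s x = S.cube.cyc s x := by
  ext y
  constructor
  · intro h
    change (S.next s).SameCycle x y
    have hn : ∀ z, (S.next s).SameCycle z (S.next s z) := fun z =>
      Equiv.Perm.sameCycle_apply_right.2 (Equiv.Perm.SameCycle.refl _ _)
    induction h with
    | refl => exact Equiv.Perm.SameCycle.refl _ _
    | symm _ _ _ ih => exact ih.symm
    | trans _ _ _ _ _ ih1 ih2 => exact ih1.trans ih2
    | rel x y hxy =>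
      rcases x with h | l <;> rcases y with h' | l'
      · have h1 := hn (Sum.inl h)
        have h2 := hn (Sum.inl h')
        rw [next_inl] at h1 h2
        cases ho : S.out h
        · rcases hxy with rfl | rfl
          · rw [S.out_edge, ho, Bool.not_false, if_pos rfl, K.edge_invol] at h2
            exact h2.symm
          · simpa [ho] using h1
        · rcases hxy with rfl | rfl
          · simpa [ho] using h1
          · simp only [S.out_arc, ho, Bool.not_true, Bool.false_eq_true, if_false,
              K.arc_arc] at h2
            exact h2.symm
      · exact hxy.elim
      · exact hxy.elim
      · exact hxy.elim
  · intro h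
    refine rel_of_sameCycle (Relation.EqvGen.is_equivalence (K.Step s)) (fun z => ?_) h
    rcases z with h | l
    · refine Relation.EqvGen.rel _ _ ?_
      change K.Step s (Sum.inl h) (Sum.inl _)
      simp only [VirtualDiagram.Step]
      split_ifs
      · exact Or.inl rfl
      · exact Or.inr rfl
    · exact Relation.EqvGen.refl _

theorem circles_eq_cycles (s : K.State) : K.circles s = S.cube.cycles s := by
  rw [VirtualDiagram.circles, SwapCube.cycles]
  congr 1
  exact funext (S.circleOf_eq_cyc s)

theorem common_eq (s t : K.State) : VirtualDiagram.Frame.common s t = S.cube.common s t := by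
  rw [VirtualDiagram.Frame.common, SwapCube.common]
  simp only [S.circles_eq_cycles]

/-- The circle through the first incoming half-edge at `v`. -/
def circA (s : K.State) (v : Fin K.n) : K.Circle s :=
  K.circle s (Sum.inl (Sum.inl v, S.cornerA v))

/-- The circle through the second incoming half-edge at `v`. -/
def circB (s : K.State) (v : Fin K.n) : K.Circle s :=
  K.circle s (Sum.inl (Sum.inl v, (S.cornerA v).straight))

theorem circA_val (s : K.State) (v : Fin K.n) :
    (S.circA s v).1 = S.cube.cyc s (S.cube.a v) := S.circleOf_eq_cyc s _

theorem circB_val (s : K.State) (v : Fin K.n) :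
    (S.circB s v).1 = S.cube.cyc s (S.cube.b v) := S.circleOf_eq_cyc s _

theorem circle_eq_iff (s : K.State) (x y : K.Point) :
    K.circle s x = K.circle s y ↔ S.cube.Rel s x y := by
  rw [← SwapCube.cyc_eq_iff, ← S.circleOf_eq_cyc, ← S.circleOf_eq_cyc]
  exact Subtype.ext_iff

omit S in
theorem circle_arc (s : K.State) (h : HalfEdge K.n K.m) :
    K.circle s (Sum.inl (K.arc s h)) = K.circle s (Sum.inl h) := by
  have h1 : Relation.EqvGen (K.Step s) (Sum.inl (K.arc s h)) (Sum.inl h) :=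
    Relation.EqvGen.rel _ _ (Or.inr (K.arc_arc s h).symm)
  refine Subtype.ext (Set.ext fun y => ⟨fun hy => ?_, fun hy => ?_⟩)
  · exact (h1.symm _ _).trans _ _ _ hy
  · exact h1.trans _ _ _ hy

theorem fst_snd_of_out_eq_false {s : K.State} {v : Fin K.n}
    (ho : S.out (Sum.inl v, Corner.nw) = false) :
    K.fst s v = S.circA s v ∧ K.snd s v = S.circB s v := by
  simp [VirtualDiagram.fst, VirtualDiagram.snd, circA, circB, cornerA, ho, Corner.straight]

theorem fst_snd_of_A {s : K.State} {v : Fin K.n} (hs : s v = false) :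
    K.fst s v = S.circA s v ∧ K.snd s v = S.circB s v := by
  cases ho : S.out (Sum.inl v, Corner.nw)
  · exact S.fst_snd_of_out_eq_false ho
  · constructor
    · rw [VirtualDiagram.fst, ← circle_arc]
      simp [circA, cornerA, ho, VirtualDiagram.arc, hs]
    · rw [VirtualDiagram.snd, ← circle_arc]
      have : Corner.se = Corner.nw.straight := rfl
      simp only [circB, cornerA, ho, VirtualDiagram.arc, hs, if_true, this, smoothing_straight]

/-- If `nw` is outgoing, then the `B`-smoothing joins it to the second incoming half-edge, so that
the order of the two circles is reversed. -/
theorem fst_snd_of_B {s : K.State} {v : Fin K.n} (hs : s v = true)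
    (ho : S.out (Sum.inl v, Corner.nw) = true) :
    K.fst s v = S.circB s v ∧ K.snd s v = S.circA s v := by
  have hnot : ∀ p c, Corner.smoothing p true c = Corner.smoothing p false c.straight :=
    fun p c => smoothing_not p false c
  constructor
  · rw [VirtualDiagram.fst, ← circle_arc]
    simp only [circB, cornerA, ho, VirtualDiagram.arc, hs, if_true, hnot, smoothing_straight]
  · rw [VirtualDiagram.snd, ← circle_arc]
    have : Corner.se.straight = Corner.nw := rfl
    simp only [circA, cornerA, ho, VirtualDiagram.arc, hs, if_true, hnot, this]

theorem fst_snd (s : K.State) (v : Fin K.n) :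
    K.fst s v = S.circA s v ∧ K.snd s v = S.circB s v ∨
      K.fst s v = S.circB s v ∧ K.snd s v = S.circA s v := by
  cases hs : s v
  · exact Or.inl (S.fst_snd_of_A hs)
  · cases ho : S.out (Sum.inl v, Corner.nw)
    · exact Or.inl (S.fst_snd_of_out_eq_false ho)
    · exact Or.inr (S.fst_snd_of_B hs ho)

theorem merges_iff_circ_ne (s : K.State) (v : Fin K.n) :
    S.cube.Merges s v ↔ S.circA s v ≠ S.circB s v :=
  (S.circle_eq_iff s _ _).not.symm

theorem fst_eq_snd_iff (s : K.State) (v : Fin K.n) :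
    K.fst s v = K.snd s v ↔ ¬ S.cube.Merges s v := by
  rw [merges_iff_circ_ne, not_not]
  rcases S.fst_snd s v with ⟨h1, h2⟩ | ⟨h1, h2⟩
  · rw [h1, h2]
  · rw [h1, h2, eq_comm]

theorem eq_flipAt {v : Fin K.n} {s t : K.State} (h : K.IsEdge v s t) : t = flipAt s v := by
  rw [h.2, flipAt, h.1, Bool.not_false]

theorem isEdge_flipAt {v : Fin K.n} {s : K.State} (h : s v = false) :
    K.IsEdge v s (flipAt s v) := ⟨h, by rw [flipAt, h, Bool.not_false]⟩

theorem isMerge_iff (v : Fin K.n) (s : K.State) :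
    K.IsMerge v s (flipAt s v) ↔ S.cube.Merges s v := by
  rw [VirtualDiagram.IsMerge, Ne, S.fst_eq_snd_iff, S.fst_eq_snd_iff, SwapCube.merges_flipAt,
    not_not, and_self]

/-- No `1 → 1` bifurcations occur. -/
theorem isSplit_iff (v : Fin K.n) (s : K.State) :
    K.IsSplit v s (flipAt s v) ↔ ¬ S.cube.Merges s v := by
  rw [VirtualDiagram.IsSplit, Ne, S.fst_eq_snd_iff, S.fst_eq_snd_iff, SwapCube.merges_flipAt,
    not_not, and_self]

end SourceSink

open MvPolynomial

/-! ### The Frobenius algebra in polynomial form -/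

namespace SwapCube

variable {ι α : Type*} [DecidableEq ι] [DecidableEq α] (Q : SwapCube ι α)

/-- The ideal by which polynomials in the points are to be divided in order to obtain the tensor
product of the algebras `ℤ[X] / (X²)` over the cycles at `s`. -/
def relIdeal (s : ι → Bool) : Ideal (MvPolynomial α ℤ) :=
  Ideal.span ({p | ∃ x y, Q.Rel s x y ∧ p = X x - X y} ∪ {p | ∃ x y, Q.Rel s x y ∧ p = X x * X y})

open Classical in
/-- The polynomial by which to multiply on the edge in the direction `v`: merging cycles is the
projection to a quotient algebra, and splitting a cycle is multiplication by `X_a + X_b = Δ(1)`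
after an arbitrary lift. -/
def edgePoly (s : ι → Bool) (v : ι) : MvPolynomial α ℤ :=
  if Q.Merges s v then 1 else X (Q.a v) + X (Q.b v)

variable {Q} {s : ι → Bool} {v w : ι} {x y : α}

theorem X_sub_X_mem (h : Q.Rel s x y) : X x - X y ∈ Q.relIdeal s :=
  Ideal.subset_span (Or.inl ⟨x, y, h, rfl⟩)

theorem X_mul_X_mem (h : Q.Rel s x y) : X x * X y ∈ Q.relIdeal s :=
  Ideal.subset_span (Or.inr ⟨x, y, h, rfl⟩)

variable [Finite α]

theorem edgePoly_mul_mem {p : MvPolynomial α ℤ} (hp : p ∈ Q.relIdeal s) :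
    Q.edgePoly s v * p ∈ Q.relIdeal (flipAt s v) := by
  rw [edgePoly]
  split_ifs with h
  · rw [one_mul]
    refine Ideal.span_mono ?_ hp
    have hle : ∀ {x y}, Q.Rel s x y → Q.Rel (flipAt s v) x y := fun h' =>
      (rel_flipAt h).2 (Or.inl h')
    rintro p (⟨x, y, hxy, rfl⟩ | ⟨x, y, hxy, rfl⟩)
    · exact Or.inl ⟨x, y, hle hxy, rfl⟩
    · exact Or.inr ⟨x, y, hle hxy, rfl⟩
  · have h' : Q.Merges (flipAt s v) v := merges_flipAt.2 h
    have hrel : ∀ {x y}, Q.Rel s x y → _ := fun {x y} hxy =>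
      (rel_flipAt (x := x) (y := y) h').1 (by rwa [flipAt_flipAt])
    set t := flipAt s v
    have haa : X (Q.a v) * X (Q.a v) ∈ Q.relIdeal t := X_mul_X_mem (Equiv.Perm.SameCycle.refl _ _)
    have hbb : X (Q.b v) * X (Q.b v) ∈ Q.relIdeal t := X_mul_X_mem (Equiv.Perm.SameCycle.refl _ _)
    -- `X_a + X_b` annihilates `X_a - X_b` and `X_a X_b`
    have h1 : ∀ {x y}, Q.Rel t (Q.a v) x → Q.Rel t (Q.b v) y →
        (X (Q.a v) + X (Q.b v)) * (X x - X y) ∈ Q.relIdeal t := by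
      intro x y hx hy
      have := Ideal.add_mem _ (Ideal.sub_mem _ haa hbb)
        (Ideal.mul_mem_left _ (X (Q.a v) + X (Q.b v))
          (Ideal.sub_mem _ (X_sub_X_mem hy) (X_sub_X_mem hx)))
      convert this using 1
      ring
    have h2 : ∀ {x y}, Q.Rel t (Q.a v) x → Q.Rel t (Q.b v) y →
        (X (Q.a v) + X (Q.b v)) * (X x * X y) ∈ Q.relIdeal t := by
      intro x y hx hy
      have := Ideal.add_mem _ (Ideal.mul_mem_left _ (X y) (X_mul_X_mem hx))
        (Ideal.mul_mem_left _ (X x) (X_mul_X_mem hy))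
      convert this using 1
      ring
    induction hp using Submodule.span_induction with
    | mem p hp =>
      rcases hp with ⟨x, y, hxy, rfl⟩ | ⟨x, y, hxy, rfl⟩
      · rcases hrel hxy with hxy | ⟨hx, hy⟩ | ⟨hx, hy⟩
        · exact Ideal.mul_mem_left _ _ (X_sub_X_mem hxy)
        · exact h1 hx hy
        · rw [← neg_sub, mul_neg]
          exact Ideal.neg_mem_iff _ |>.2 (h1 hy hx)
      · rcases hrel hxy with hxy | ⟨hx, hy⟩ | ⟨hx, hy⟩
        · exact Ideal.mul_mem_left _ _ (X_mul_X_mem hxy)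
        · exact h2 hx hy
        · rw [mul_comm (X x)]
          exact h2 hy hx
    | zero => simp
    | add p q _ _ hp hq => rw [mul_add]; exact Ideal.add_mem _ hp hq
    | smul r p _ hp =>
      rw [smul_eq_mul, mul_left_comm]
      exact Ideal.mul_mem_left _ _ hp

omit [Finite α] in
theorem X_add_X_sub_mem {w' z : α} (h : Q.Rel s x w' ∧ Q.Rel s y z ∨ Q.Rel s y w' ∧ Q.Rel s x z) :
    X x + X y - (X w' + X z) ∈ Q.relIdeal s := by
  rcases h with ⟨h1, h2⟩ | ⟨h1, h2⟩
  · convert Ideal.add_mem _ (X_sub_X_mem h1) (X_sub_X_mem h2) using 1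
    ring
  · convert Ideal.add_mem _ (X_sub_X_mem h1) (X_sub_X_mem h2) using 1
    ring

open Classical in
/-- The faces of the cube commute on the level of the algebras. -/
theorem edgePoly_face (s : ι → Bool) (v w : ι) :
    Q.edgePoly (flipAt s v) w * Q.edgePoly s v - Q.edgePoly (flipAt s w) v * Q.edgePoly s w ∈
      Q.relIdeal (flipAt (flipAt s v) w) := by
  have hface := @merges_face _ _ _ _ Q s v w _
  by_cases hs : (Q.Merges s v ↔ Q.Merges (flipAt s w) v) ∧ (Q.Merges s w ↔ Q.Merges (flipAt s v) w)
  · have e1 : Q.edgePoly s v = Q.edgePoly (flipAt s w) v := by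
      rw [edgePoly, edgePoly]; simp only [hs.1]
    have e2 : Q.edgePoly s w = Q.edgePoly (flipAt s v) w := by
      rw [edgePoly, edgePoly]; simp only [hs.2]
    rw [e1, e2, mul_comm, sub_self]
    exact Ideal.zero_mem _
  by_cases hv : Q.Merges s v
  · have hw : Q.Merges s w := by tauto
    have hvw : ¬ Q.Merges (flipAt s v) w := by tauto
    have hwv : ¬ Q.Merges (flipAt s w) v := by tauto
    rw [edgePoly, edgePoly, edgePoly, edgePoly, if_pos hv, if_pos hw, if_neg hvw, if_neg hwv,
      mul_one, mul_one, ← neg_sub]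
    refine (Ideal.neg_mem_iff _).2 (X_add_X_sub_mem ?_)
    have htv : Q.Merges (flipAt (flipAt s v) w) v := by
      rw [flipAt_comm]; exact merges_flipAt.2 hwv
    refine rel_of_merges_not_merges htv (merges_flipAt.2 hvw) ?_
    rw [flipAt_comm s v w, flipAt_flipAt]
    exact fun e => merges_flipAt.1 e hw
  · have hw : ¬ Q.Merges s w := by tauto
    have hvw : Q.Merges (flipAt s v) w := by tauto
    have hwv : Q.Merges (flipAt s w) v := by tauto
    rw [edgePoly, edgePoly, edgePoly, edgePoly, if_neg hv, if_neg hw, if_pos hvw, if_pos hwv,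
      one_mul, one_mul]
    -- at the end of the face all four points lie on one cycle
    have hr := rel_of_merges_not_merges (merges_flipAt.2 hv) hvw (by rwa [flipAt_flipAt])
    have hab : Q.Rel (flipAt (flipAt s v) w) (Q.a v) (Q.b v) := by
      by_contra h
      have h' : Q.Merges (flipAt (flipAt s w) v) v := by rwa [flipAt_comm]
      exact merges_flipAt.1 h' hwv
    have hle : ∀ {x y}, Q.Rel (flipAt s v) x y → Q.Rel (flipAt (flipAt s v) w) x y := fun h' =>
      (rel_flipAt hvw).2 (Or.inl h')
    refine X_add_X_sub_mem ?_
    exact hr.imp (fun h => ⟨hle h.1, hle h.2⟩) (fun h => ⟨hle h.1, hle h.2⟩)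

end SwapCube

/-! ### Matrix entries as coefficients of polynomials -/

section Labels

variable {K : VirtualDiagram}

/-- A point on a circle. -/
def rep {s : K.State} (C : K.Circle s) : K.Point := C.2.choose

theorem circle_rep {s : K.State} (C : K.Circle s) : K.circle s (rep C) = C :=
  Subtype.ext C.2.choose_spec

/-- The exponents of the squarefree monomial that corresponds to a labelling: the product of the
variables of the circles labelled `X`. -/
def labelExp {s : K.State} (ℓ : K.Circle s → Label) : K.Circle s →₀ ℕ :=
  Finsupp.equivFunOnFinite.symm fun C => if ℓ C = Label.X then 1 else 0

theorem labelExp_apply {s : K.State} (ℓ : K.Circle s → Label) (C : K.Circle s) :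
    labelExp ℓ C = if ℓ C = Label.X then 1 else 0 := rfl

/-- The monomial of a labelling, in the variables of chosen points on the circles. -/
def labelMonomial {s : K.State} (ℓ : K.Circle s → Label) : MvPolynomial K.Point ℤ :=
  monomial (Finsupp.mapDomain rep (labelExp ℓ)) 1

/-- The coefficient at a labelling of the element represented by a polynomial in the points. -/
def labelCoeff {s : K.State} (ℓ : K.Circle s → Label) : MvPolynomial K.Point ℤ →ₗ[ℤ] ℤ :=
  lcoeff ℤ (labelExp ℓ) ∘ₗ (rename (K.circle s) (R := ℤ)).toLinearMap

theorem labelCoeff_apply {s : K.State} (ℓ : K.Circle s → Label) (p : MvPolynomial K.Point ℤ) :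
    labelCoeff ℓ p = coeff (labelExp ℓ) (rename (K.circle s) p) := rfl

theorem labelExp_injective {s : K.State} :
    Function.Injective (labelExp : (K.Circle s → Label) → _) := by
  intro ℓ ℓ' h
  funext C
  have := DFunLike.congr_fun h C
  rw [labelExp_apply, labelExp_apply] at this
  cases h1 : ℓ C <;> cases h2 : ℓ' C <;> simp_all

theorem labelCoeff_labelMonomial {s : K.State} (ℓ ℓ' : K.Circle s → Label) :
    labelCoeff ℓ' (labelMonomial ℓ) = if ℓ = ℓ' then 1 else 0 := by
  classical
  rw [labelCoeff_apply, labelMonomial, rename_monomial, ← Finsupp.mapDomain_comp, coeff_monomial]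
  have : K.circle s ∘ rep = id := funext circle_rep
  rw [this, Finsupp.mapDomain_id]
  simp only [labelExp_injective.eq_iff]

theorem labelCoeff_eq_zero_of_mem (S : SourceSink K) {s : K.State} (ℓ : K.Circle s → Label)
    {p : MvPolynomial K.Point ℤ} (hp : p ∈ S.cube.relIdeal s) : labelCoeff ℓ p = 0 := by
  classical
  suffices H : ∀ r, labelCoeff ℓ (r * p) = 0 by simpa using H 1
  induction hp using Submodule.span_induction with
  | mem p hp =>
    intro r
    rw [labelCoeff_apply, map_mul]
    rcases hp with ⟨x, y, hxy, rfl⟩ | ⟨x, y, hxy, rfl⟩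
    · rw [map_sub, rename_X, rename_X, (S.circle_eq_iff s x y).2 hxy, sub_self, mul_zero,
        coeff_zero]
    · have h2 : (X (K.circle s y) * X (K.circle s y) : MvPolynomial (K.Circle s) ℤ) =
          monomial (Finsupp.single (K.circle s y) 2) 1 := by
        rw [← sq, X_pow_eq_monomial]
      rw [map_mul, rename_X, rename_X, (S.circle_eq_iff s x y).2 hxy, h2, coeff_mul_monomial',
        if_neg]
      intro hle
      have := hle (K.circle s y)
      rw [Finsupp.single_eq_same, labelExp_apply] at this
      split_ifs at this <;> omega
  | zero => simp
  | add p q _ _ hp hq => intro r; rw [mul_add, map_add, hp, hq, add_zero]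
  | smul c p _ hp => intro r; rw [smul_eq_mul, ← mul_assoc]; exact hp _

theorem labelMonomial_update {s : K.State} {ℓ : K.Circle s → Label} {C : K.Circle s}
    (h : ℓ C = Label.one) :
    labelMonomial (Function.update ℓ C Label.X) = labelMonomial ℓ * X (rep C) := by
  rw [labelMonomial, labelMonomial, X, monomial_mul, mul_one, ← Finsupp.mapDomain_single,
    ← Finsupp.mapDomain_add]
  congr 2
  suffices H : labelExp (Function.update ℓ C Label.X) = labelExp ℓ + Finsupp.single C 1 by rw [H]
  refine Finsupp.ext fun D => ?_
  rw [Finsupp.add_apply, labelExp_apply, labelExp_apply]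
  rcases eq_or_ne D C with rfl | hD
  · simp [h]
  · simp [Function.update_of_ne hD, Finsupp.single_eq_of_ne hD]

theorem mem_span_labelMonomial (S : SourceSink K) (s : K.State) (p : MvPolynomial K.Point ℤ) :
    p ∈ Submodule.span ℤ (Set.range (labelMonomial : (K.Circle s → Label) → _)) ⊔
      (S.cube.relIdeal s).restrictScalars ℤ := by
  induction p using MvPolynomial.induction_on with
  | C r =>
    refine Submodule.mem_sup_left ?_
    have h1 : labelMonomial (fun _ : K.Circle s => Label.one) = 1 := by
      have : labelExp (fun _ : K.Circle s => Label.one) = 0 := by ext; simp [labelExp_apply]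
      rw [labelMonomial, this, Finsupp.mapDomain_zero]
      rfl
    have h2 : (C r : MvPolynomial K.Point ℤ) =
        r • labelMonomial (fun _ : K.Circle s => Label.one) := by
      rw [h1, smul_eq_C_mul, mul_one]
    rw [h2]
    exact Submodule.smul_mem _ _ (Submodule.subset_span ⟨_, rfl⟩)
  | add p q hp hq => exact Submodule.add_mem _ hp hq
  | mul_X p x hp =>
    obtain ⟨u, hu, j, hj, rfl⟩ := Submodule.mem_sup.1 hp
    rw [add_mul]
    refine Submodule.add_mem _ ?_ (Submodule.mem_sup_right (Ideal.mul_mem_right _ _ hj))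
    clear hp
    induction hu using Submodule.span_induction with
    | mem u hu =>
      obtain ⟨ℓ, rfl⟩ := hu
      have hrel : S.cube.Rel s (rep (K.circle s x)) x :=
        (S.circle_eq_iff s _ _).1 (circle_rep _)
      cases hl : ℓ (K.circle s x)
      · have e : labelMonomial ℓ * X x = labelMonomial (Function.update ℓ (K.circle s x) Label.X) +
            -(labelMonomial ℓ * (X (rep (K.circle s x)) - X x)) := by
          rw [labelMonomial_update hl]; ring
        rw [e]
        refine Submodule.add_mem_sup (Submodule.subset_span ⟨_, rfl⟩) ?_
        exact Submodule.neg_mem _ (Ideal.mul_mem_left _ _ (SwapCube.X_sub_X_mem hrel))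
      · refine Submodule.mem_sup_right ?_
        have e := labelMonomial_update (ℓ := Function.update ℓ (K.circle s x) Label.one)
          (C := K.circle s x) (by simp)
        rw [Function.update_idem, ← hl, Function.update_eq_self] at e
        rw [e, mul_assoc]
        exact Ideal.mul_mem_left _ _ (SwapCube.X_mul_X_mem hrel)
    | zero => rw [zero_mul]; exact Submodule.zero_mem _
    | add u u' _ _ hu hu' => rw [add_mul]; exact Submodule.add_mem _ hu hu'
    | smul c u _ hu => rw [smul_mul_assoc]; exact Submodule.smul_mem _ _ hu

/-- Labellings are a basis of the quotient algebra. -/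
theorem sub_sum_labelCoeff_mem (S : SourceSink K) (s : K.State) (p : MvPolynomial K.Point ℤ) :
    p - ∑ ℓ : K.Circle s → Label, labelCoeff ℓ p • labelMonomial ℓ ∈ S.cube.relIdeal s := by
  classical
  obtain ⟨u, hu, j, hj, rfl⟩ := Submodule.mem_sup.1 (mem_span_labelMonomial S s p)
  obtain ⟨c, rfl⟩ := (Submodule.mem_span_range_iff_exists_fun ℤ).1 hu
  have hc : ∀ ℓ : K.Circle s → Label,
      labelCoeff ℓ (∑ ℓ', c ℓ' • labelMonomial ℓ' + j) = c ℓ := by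
    intro ℓ
    rw [map_add, labelCoeff_eq_zero_of_mem S ℓ hj, add_zero, map_sum]
    simp only [map_zsmul, labelCoeff_labelMonomial]
    simp
  simp only [hc, add_sub_cancel_left]
  exact hj

end Labels

section Coefficients

variable {K : VirtualDiagram} (S : SourceSink K) {s t : K.State} {v w : Fin K.n}

namespace SourceSink

theorem circle_cases_before (h : S.cube.Merges s v) (C : K.Circle s) :
    C.1 ∈ K.circles (flipAt s v) ∨ C = S.circA s v ∨ C = S.circB s v := by
  obtain ⟨C, hC⟩ := C
  have hC' := hC
  rw [S.circles_eq_cycles, SwapCube.cycles_eq_of_merges h, ← S.circles_eq_cycles,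
    ← S.circles_eq_cycles, ← S.circA_val, ← S.circB_val] at hC'
  rcases hC' with hC | hC | hC
  · exact Or.inr (Or.inl (Subtype.ext hC))
  · exact Or.inr (Or.inr (Subtype.ext hC))
  · exact Or.inl hC.2

theorem circle_cases_after (h : S.cube.Merges s v) (C : K.Circle (flipAt s v)) :
    C.1 ∈ K.circles s ∨ C = S.circA (flipAt s v) v := by
  obtain ⟨C, hC⟩ := C
  have hC' := hC
  rw [S.circles_eq_cycles, SwapCube.cycles_flipAt_eq_of_merges h, ← S.circles_eq_cycles,
    ← S.circles_eq_cycles, ← S.circA_val] at hC'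
  rcases hC' with hC | hC
  · exact Or.inr (Subtype.ext hC)
  · exact Or.inl hC.1

theorem circA_notMem (h : S.cube.Merges s v) : (S.circA s v).1 ∉ K.circles (flipAt s v) := by
  rw [S.circA_val, S.circles_eq_cycles]
  exact SwapCube.cyc_a_notMem h

theorem circB_notMem (h : S.cube.Merges s v) : (S.circB s v).1 ∉ K.circles (flipAt s v) := by
  rw [S.circB_val, S.circles_eq_cycles]
  exact SwapCube.cyc_b_notMem h

theorem circA_flipAt_notMem (h : S.cube.Merges s v) :
    (S.circA (flipAt s v) v).1 ∉ K.circles s := by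
  rw [S.circA_val, S.circles_eq_cycles]
  exact SwapCube.cyc_flipAt_a_notMem h

open Classical in
/-- Products over the circles at the two ends of an edge of the cube, where `s` is the end with more
circles, differ only by the factors of the circles that touch the crossing. -/
@[to_additive]
theorem prod_circles {M : Type*} [CommMonoid M] (h : S.cube.Merges s v) (ht : t = flipAt s v)
    (f : K.Circle s → M) (f' : K.Circle t → M)
    (hff : ∀ C C', C.1 = C'.1 → f C = f' C') :
    ∃ P, ∏ C, f C = f (S.circA s v) * f (S.circB s v) * P ∧ ∏ C, f' C = f' (S.circA t v) * P := by
  subst ht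
  refine ⟨∏ C ∈ Finset.univ.filter (fun C : K.Circle s => C.1 ∈ K.circles (flipAt s v)), f C,
    ?_, ?_⟩
  · have : (Finset.univ : Finset (K.Circle s)) = insert (S.circA s v) (insert (S.circB s v)
        (Finset.univ.filter fun C : K.Circle s => C.1 ∈ K.circles (flipAt s v))) := by
      ext C
      have := S.circle_cases_before h C
      simp only [Finset.mem_univ, Finset.mem_insert, Finset.mem_filter, true_and, true_iff]
      tauto
    conv_lhs => rw [this]
    rw [Finset.prod_insert, Finset.prod_insert, mul_assoc]
    · simpa using S.circB_notMem h
    · simpa [(S.merges_iff_circ_ne s v).1 h] using S.circA_notMem h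
  · have : (Finset.univ : Finset (K.Circle (flipAt s v))) = insert (S.circA (flipAt s v) v)
        (Finset.univ.filter fun C : K.Circle (flipAt s v) => C.1 ∈ K.circles s) := by
      ext C
      have := S.circle_cases_after h C
      simp only [Finset.mem_univ, Finset.mem_insert, Finset.mem_filter, true_and, true_iff]
      tauto
    conv_lhs => rw [this]
    rw [Finset.prod_insert (by simpa using S.circA_flipAt_notMem h)]
    congr 1
    refine Finset.prod_bij' (fun C hC => ⟨C.1, (Finset.mem_filter.1 hC).2⟩)
      (fun C hC => ⟨C.1, (Finset.mem_filter.1 hC).2⟩) ?_ ?_ ?_ ?_ ?_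
    · intro C _; simp
    · intro C _; simp
    · intro C _; rfl
    · intro C _; rfl
    · intro C _; exact (hff _ _ rfl).symm

end SourceSink

/-- The exponents, at the state `t`, of the monomial of a labelling of `s`. -/
def pushExp (t : K.State) (ℓ : K.Circle s → Label) : K.Circle t →₀ ℕ :=
  Finsupp.mapDomain (K.circle t ∘ rep) (labelExp ℓ)

theorem pushExp_apply (t : K.State) (ℓ : K.Circle s → Label) (C' : K.Circle t) :
    pushExp t ℓ C' = ∑ C, if K.circle t (rep C) = C' then labelExp ℓ C else 0 := by
  rw [pushExp, Finsupp.mapDomain, Finsupp.sum_fintype _ _ (by simp), Finsupp.finsetSum_apply]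
  refine Finset.sum_congr rfl fun C _ => ?_
  rw [Finsupp.single_apply, Function.comp]

theorem labelCoeff_labelMonomial' (ℓ : K.Circle s → Label) (ℓ' : K.Circle t → Label) :
    labelCoeff ℓ' (labelMonomial ℓ) = if pushExp t ℓ = labelExp ℓ' then 1 else 0 := by
  rw [labelCoeff_apply, labelMonomial, rename_monomial, ← Finsupp.mapDomain_comp, coeff_monomial]
  rfl

theorem labelCoeff_X_mul_labelMonomial (ℓ : K.Circle s → Label) (ℓ' : K.Circle t → Label)
    (x : K.Point) : labelCoeff ℓ' (X x * labelMonomial ℓ) =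
      if Finsupp.single (K.circle t x) 1 + pushExp t ℓ = labelExp ℓ' then 1 else 0 := by
  rw [labelCoeff_apply, labelMonomial, map_mul, rename_X, rename_monomial,
    ← Finsupp.mapDomain_comp, X, monomial_mul, mul_one, coeff_monomial]
  rfl

include S in
theorem circle_eq_of_mem {C : Set K.Point} (hC : C ∈ K.circles s) {x : K.Point} (hx : x ∈ C) :
    (K.circle s x).1 = C := by
  rw [S.circles_eq_cycles] at hC
  exact (S.circleOf_eq_cyc s x).trans (SwapCube.cyc_eq_of_mem hC hx)

include S in
theorem mem_circle_iff {C : K.Circle s} {x : K.Point} : x ∈ C.1 ↔ K.circle s x = C := by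
  constructor
  · exact fun h => Subtype.ext (circle_eq_of_mem S C.2 h)
  · rintro rfl
    exact Relation.EqvGen.refl _

include S in
theorem pushExp_of_mem (ℓ : K.Circle s → Label) (C' : K.Circle t) (h : C'.1 ∈ K.circles s) :
    pushExp t ℓ C' = labelExp ℓ ⟨C'.1, h⟩ := by
  rw [pushExp_apply, Finset.sum_eq_single ⟨C'.1, h⟩, if_pos]
  · exact (mem_circle_iff S).1 ((mem_circle_iff S (C := ⟨C'.1, h⟩)).2 (circle_rep _))
  · intro C _ hC
    refine if_neg fun e => hC ?_
    have h1 : rep C ∈ C'.1 := (mem_circle_iff S).2 e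
    rw [← circle_rep C]
    exact Subtype.ext (circle_eq_of_mem S h h1)
  · simp

theorem pushExp_circA_of_merges (h : S.cube.Merges s v) (ℓ : K.Circle s → Label) :
    pushExp (flipAt s v) ℓ (S.circA (flipAt s v) v) =
      labelExp ℓ (S.circA s v) + labelExp ℓ (S.circB s v) := by
  rw [pushExp_apply, ← Finset.sum_subset (Finset.subset_univ {S.circA s v, S.circB s v}),
    Finset.sum_pair ((S.merges_iff_circ_ne s v).1 h), if_pos, if_pos]
  · refine (S.circle_eq_iff _ _ _).2 ((SwapCube.rel_flipAt h).2 (Or.inr (Or.inr ⟨?_, ?_⟩)))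
    · exact (S.circle_eq_iff _ _ _).1 (circle_rep (S.circB s v)).symm
    · exact Equiv.Perm.SameCycle.refl _ _
  · refine (S.circle_eq_iff _ _ _).2 ((SwapCube.rel_flipAt h).2 (Or.inl ?_))
    exact (S.circle_eq_iff _ _ _).1 (circle_rep (S.circA s v))
  · intro C _ hC
    refine if_neg fun e => hC ?_
    have h1 : rep C ∈ (S.circA (flipAt s v) v).1 := (mem_circle_iff S).2 e
    rw [S.circA_val, SwapCube.cyc_flipAt_a h, ← S.circA_val, ← S.circB_val, Set.mem_union,
      mem_circle_iff S, mem_circle_iff S, circle_rep] at h1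
    simpa using h1

/-- At a splitting edge, the monomial of a labelling of `s` contributes to the two new circles. -/
theorem pushExp_of_split (h : ¬ S.cube.Merges s v) (ℓ : K.Circle s → Label) :
    (pushExp (flipAt s v) ℓ (S.circA (flipAt s v) v) = labelExp ℓ (S.circA s v) ∧
      pushExp (flipAt s v) ℓ (S.circB (flipAt s v) v) = 0) ∨
    (pushExp (flipAt s v) ℓ (S.circA (flipAt s v) v) = 0 ∧
      pushExp (flipAt s v) ℓ (S.circB (flipAt s v) v) = labelExp ℓ (S.circA s v)) := by
  have h' : S.cube.Merges (flipAt s v) v := SwapCube.merges_flipAt.2 h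
  have hu : (S.circA s v).1 = (S.circA (flipAt s v) v).1 ∪ (S.circB (flipAt s v) v).1 := by
    have := SwapCube.cyc_flipAt_a h'
    rwa [flipAt_flipAt, ← S.circA_val, ← S.circA_val, ← S.circB_val] at this
  have hval : ∀ C', C' = S.circA (flipAt s v) v ∨ C' = S.circB (flipAt s v) v →
      pushExp (flipAt s v) ℓ C' =
      if K.circle (flipAt s v) (rep (S.circA s v)) = C' then labelExp ℓ (S.circA s v) else 0 := by
    intro C' hC'
    rw [pushExp_apply, Finset.sum_eq_single (S.circA s v)]
    · intro C _ hC
      refine if_neg fun e => hC ?_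
      have h1 : rep C ∈ C'.1 := (mem_circle_iff S).2 e
      rw [← circle_rep C, ← mem_circle_iff S, hu]
      rcases hC' with rfl | rfl
      · exact Or.inl h1
      · exact Or.inr h1
    · simp
  have hne := (S.merges_iff_circ_ne _ v).1 h'
  have hr : rep (S.circA s v) ∈ (S.circA s v).1 := (mem_circle_iff S).2 (circle_rep _)
  rw [hval _ (Or.inl rfl), hval _ (Or.inr rfl)]
  rw [hu, Set.mem_union, mem_circle_iff S, mem_circle_iff S] at hr
  rcases hr with hr | hr
  · rw [hr, if_pos rfl, if_neg hne]
    exact Or.inl ⟨rfl, rfl⟩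
  · rw [hr, if_pos rfl, if_neg hne.symm]
    exact Or.inr ⟨rfl, rfl⟩

/-- The coefficient of `m` or `Δ` on the labels of the circles at the crossing `v`, with these
circles named by the incoming half-edges. -/
def labelEntry (v : Fin K.n) (e e' : K.Enhanced) : ℤ :=
  open Classical in
  if S.cube.Merges e.1 v then
    Label.mulCoeff (e.2 (S.circA e.1 v)) (e.2 (S.circB e.1 v)) (e'.2 (S.circA e'.1 v))
  else Label.comulCoeff (e.2 (S.circA e.1 v)) (e'.2 (S.circA e'.1 v)) (e'.2 (S.circB e'.1 v))

include S in
theorem pushExp_eq_iff_compatible (ℓ : K.Circle s → Label) (ℓ' : K.Circle t → Label) :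
    (∀ C' : K.Circle t, C'.1 ∈ K.circles s → pushExp t ℓ C' = labelExp ℓ' C') ↔
      K.Compatible ⟨s, ℓ⟩ ⟨t, ℓ'⟩ := by
  have hbit : ∀ p q : Label, ((if p = Label.X then 1 else 0) = if q = Label.X then 1 else 0) ↔
      p = q := by
    intro p q
    cases p <;> cases q <;> simp
  constructor
  · intro h C C' e
    have hm : C'.1 ∈ K.circles s := e ▸ C.2
    have := h C' hm
    rw [pushExp_of_mem S ℓ C' hm, labelExp_apply, labelExp_apply, hbit] at this
    exact (congrArg ℓ (Subtype.ext e)).trans this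
  · intro h C' hm
    rw [pushExp_of_mem S ℓ C' hm, labelExp_apply, labelExp_apply, hbit]
    exact h _ _ rfl

open Classical in
/-- The matrix entries of `m` and `Δ` are those of the multiplication by `edgePoly`. -/
theorem labelCoeff_edgePoly_mul (ℓ : K.Circle s → Label) (ℓ' : K.Circle (flipAt s v) → Label) :
    labelCoeff ℓ' (S.cube.edgePoly s v * labelMonomial ℓ) =
      if K.Compatible ⟨s, ℓ⟩ ⟨flipAt s v, ℓ'⟩ then
        labelEntry S v ⟨s, ℓ⟩ ⟨flipAt s v, ℓ'⟩ else 0 := by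
  have hcomp := pushExp_eq_iff_compatible S ℓ ℓ'
  by_cases h : S.cube.Merges s v
  · have hA := pushExp_circA_of_merges S h ℓ
    have hiff : pushExp (flipAt s v) ℓ = labelExp ℓ' ↔ K.Compatible ⟨s, ℓ⟩ ⟨flipAt s v, ℓ'⟩ ∧
        labelExp ℓ (S.circA s v) + labelExp ℓ (S.circB s v) =
          labelExp ℓ' (S.circA (flipAt s v) v) := by
      rw [← hcomp, ← hA]
      constructor
      · intro e
        rw [e]
        exact ⟨fun _ _ => rfl, rfl⟩
      · rintro ⟨h1, h2⟩
        refine Finsupp.ext fun C' => ?_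
        rcases S.circle_cases_after h C' with hC | rfl
        · exact h1 C' hC
        · exact h2
    rw [SwapCube.edgePoly, if_pos h, one_mul, labelCoeff_labelMonomial']
    simp only [hiff, labelEntry, h, if_true, labelExp_apply]
    generalize ℓ (S.circA s v) = p
    generalize ℓ (S.circB s v) = q
    generalize ℓ' (S.circA (flipAt s v) v) = r
    by_cases hc : K.Compatible ⟨s, ℓ⟩ ⟨flipAt s v, ℓ'⟩
    · cases p <;> cases q <;> cases r <;> simp [hc, Label.mulCoeff]
    · simp [hc]
  · have h' : S.cube.Merges (flipAt s v) v := SwapCube.merges_flipAt.2 h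
    have hne := (S.merges_iff_circ_ne _ v).1 h'
    have hiff : ∀ D, D = S.circA (flipAt s v) v ∨ D = S.circB (flipAt s v) v →
        (Finsupp.single D 1 + pushExp (flipAt s v) ℓ = labelExp ℓ' ↔
        K.Compatible ⟨s, ℓ⟩ ⟨flipAt s v, ℓ'⟩ ∧
        (Finsupp.single D 1 (S.circA (flipAt s v) v) +
          pushExp (flipAt s v) ℓ (S.circA (flipAt s v) v) =
          labelExp ℓ' (S.circA (flipAt s v) v) ∧
        Finsupp.single D 1 (S.circB (flipAt s v) v) +
          pushExp (flipAt s v) ℓ (S.circB (flipAt s v) v) =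
          labelExp ℓ' (S.circB (flipAt s v) v))) := by
      intro D hD
      have hD0 : ∀ C' : K.Circle (flipAt s v), C'.1 ∈ K.circles s → Finsupp.single D 1 C' = 0 := by
        intro C' hC'
        refine Finsupp.single_eq_of_ne ?_
        rintro rfl
        have h0 : C'.1 ∈ K.circles (flipAt (flipAt s v) v) := by rwa [flipAt_flipAt]
        rcases hD with rfl | rfl
        · exact S.circA_notMem h' h0
        · exact S.circB_notMem h' h0
      rw [← hcomp]
      constructor
      · intro e
        refine ⟨fun C' hC' => ?_, ?_, ?_⟩
        · rw [← e, Finsupp.add_apply, hD0 C' hC', zero_add]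
        · rw [← e, Finsupp.add_apply]
        · rw [← e, Finsupp.add_apply]
      · rintro ⟨h1, h2, h3⟩
        refine Finsupp.ext fun C' => ?_
        rw [Finsupp.add_apply]
        rcases S.circle_cases_before h' C' with hC | rfl | rfl
        · rw [flipAt_flipAt] at hC
          rw [hD0 C' hC, zero_add]
          exact h1 C' hC
        · exact h2
        · exact h3
    rw [SwapCube.edgePoly, if_neg h, add_mul, map_add, labelCoeff_X_mul_labelMonomial,
      labelCoeff_X_mul_labelMonomial]
    change (if Finsupp.single (S.circA (flipAt s v) v) 1 + _ = _ then (1 : ℤ) else 0) +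
      (if Finsupp.single (S.circB (flipAt s v) v) 1 + _ = _ then (1 : ℤ) else 0) = _
    simp only [hiff _ (Or.inl rfl), hiff _ (Or.inr rfl), Finsupp.single_eq_same,
      Finsupp.single_eq_of_ne hne, Finsupp.single_eq_of_ne hne.symm, labelEntry, h, if_false]
    by_cases hc : K.Compatible ⟨s, ℓ⟩ ⟨flipAt s v, ℓ'⟩
    · rcases pushExp_of_split S h ℓ with ⟨h1, h2⟩ | ⟨h1, h2⟩ <;>
      · simp only [h1, h2, labelExp_apply, hc, true_and, if_true]
        generalize ℓ (S.circA s v) = p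
        generalize ℓ' (S.circA (flipAt s v) v) = q
        generalize ℓ' (S.circB (flipAt s v) v) = r
        cases p <;> cases q <;> cases r <;> simp [Label.comulCoeff]
    · simp [hc]

end Coefficients

/-! ### The usual complex -/

section CubeSign

variable {n : ℕ}

/-- The sign of the edge in the direction `v`: `(-1)^k`, where `k` is the number of coordinates
before `v` that are equal to `1`. -/
def cubeSign (s : Fin n → Bool) (v : Fin n) : ℤ :=
  (-1) ^ (Finset.univ.filter fun w => w < v ∧ s w = true).card

theorem cubeSign_eq_prod (s : Fin n → Bool) (v : Fin n) :
    cubeSign s v = ∏ w, if w < v ∧ s w = true then (-1 : ℤ) else 1 := by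
  rw [cubeSign, Finset.prod_ite, Finset.prod_const, Finset.prod_const_one, mul_one]

theorem cubeSign_mul_self (s : Fin n → Bool) (v : Fin n) : cubeSign s v * cubeSign s v = 1 := by
  rw [cubeSign, ← mul_pow]
  simp

theorem cubeSign_flipAt (s : Fin n → Bool) (v w : Fin n) :
    cubeSign (flipAt s v) w = if v < w then -cubeSign s w else cubeSign s w := by
  rw [cubeSign_eq_prod, cubeSign_eq_prod, Fintype.prod_eq_mul_prod_compl v,
    Fintype.prod_eq_mul_prod_compl v fun x => if x < w ∧ s x = true then (-1 : ℤ) else 1]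
  have : ∏ x ∈ {v}ᶜ, (if x < w ∧ flipAt s v x = true then (-1 : ℤ) else 1) =
      ∏ x ∈ {v}ᶜ, if x < w ∧ s x = true then (-1 : ℤ) else 1 := by
    refine Finset.prod_congr rfl fun x hx => ?_
    rw [flipAt_of_ne s (by simpa using hx)]
  rw [this, flipAt_self]
  split_ifs <;> simp_all

theorem cubeSign_flipAt_self (s : Fin n → Bool) (v : Fin n) :
    cubeSign (flipAt s v) v = cubeSign s v := by
  rw [cubeSign_flipAt, if_neg (lt_irrefl v)]

theorem cubeSign_swap (s : Fin n → Bool) {v w : Fin n} (h : v ≠ w) :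
    cubeSign s v * cubeSign (flipAt s v) w = -(cubeSign s w * cubeSign (flipAt s w) v) := by
  rw [cubeSign_flipAt, cubeSign_flipAt]
  rcases h.lt_or_gt with h | h
  · rw [if_pos h, if_neg h.not_gt]
    ring
  · rw [if_pos h, if_neg h.not_gt]
    ring

theorem cubeSign_face (s : Fin n → Bool) {v w : Fin n} (h : v ≠ w) :
    cubeSign s v * cubeSign (flipAt s v) w * (cubeSign s w * cubeSign (flipAt s w) v) = -1 := by
  rw [cubeSign_swap s h, neg_mul, mul_mul_mul_comm, cubeSign_mul_self, cubeSign_mul_self, one_mul]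

end CubeSign

section Usual

variable {K : VirtualDiagram} (S : SourceSink K)

open Classical in
/-- The matrix of the maps `m` and `Δ` on the edges in the direction `v`, without signs. -/
def plainCoeff (v : Fin K.n) (e e' : K.Enhanced) : ℤ :=
  if K.IsEdge v e.1 e'.1 ∧ K.Compatible e e' then labelEntry S v e e' else 0

variable {S} {v w : Fin K.n}

theorem comulCoeff_comm (p q r : Label) : Label.comulCoeff p q r = Label.comulCoeff p r q := by
  cases p <;> cases q <;> cases r <;> rfl

variable (S) in
theorem usualEdgeCoeff_eq (v : Fin K.n) (e e' : K.Enhanced) :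
    K.usualEdgeCoeff v e e' = cubeSign e.1 v * plainCoeff S v e e' := by
  obtain ⟨s, ℓ⟩ := e
  obtain ⟨t, ℓ'⟩ := e'
  rw [VirtualDiagram.usualEdgeCoeff, plainCoeff]
  by_cases h : K.IsEdge v s t ∧ K.Compatible ⟨s, ℓ⟩ ⟨t, ℓ'⟩
  · rw [if_pos h, if_pos h]
    obtain rfl := SourceSink.eq_flipAt h.1
    rw [cubeSign, labelEntry]
    dsimp only
    congr 1
    have hs : s v = false := h.1.1
    obtain ⟨e1, e2⟩ := S.fst_snd_of_A hs
    rw [e1, e2]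
    by_cases hm : S.cube.Merges s v
    · have hA : S.circA (flipAt s v) v = S.circB (flipAt s v) v := by
        by_contra hne
        exact SwapCube.merges_flipAt.1 ((S.merges_iff_circ_ne _ v).2 hne) hm
      rw [if_pos hm, if_pos ((S.isMerge_iff v s).2 hm)]
      rcases S.fst_snd (flipAt s v) v with ⟨h1, _⟩ | ⟨h1, _⟩
      · rw [h1]
      · rw [h1, hA]
    · rw [if_neg hm, if_neg (mt (S.isMerge_iff v s).1 hm), if_pos ((S.isSplit_iff v s).2 hm)]
      rcases S.fst_snd (flipAt s v) v with ⟨h1, h2⟩ | ⟨h1, h2⟩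
      · rw [h1, h2]
      · rw [h1, h2, comulCoeff_comm]
  · rw [if_neg h, if_neg h, mul_zero]

theorem sum_enhanced {M : Type*} [AddCommMonoid M] (f : K.Enhanced → M) :
    ∑ e, f e = ∑ s : K.State, ∑ ℓ : K.Circle s → Label, f ⟨s, ℓ⟩ := by
  rw [← Fintype.sum_sigma]
  exact Finset.sum_congr (Finset.ext fun _ => by simp) fun _ _ => rfl

theorem plainCoeff_eq_labelCoeff {s : K.State} (hs : s v = false) (ℓ : K.Circle s → Label)
    (ℓ' : K.Circle (flipAt s v) → Label) :
    plainCoeff S v ⟨s, ℓ⟩ ⟨flipAt s v, ℓ'⟩ =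
      labelCoeff ℓ' (S.cube.edgePoly s v * labelMonomial ℓ) := by
  rw [labelCoeff_edgePoly_mul, plainCoeff]
  have h := SourceSink.isEdge_flipAt hs
  by_cases hc : K.Compatible ⟨s, ℓ⟩ ⟨flipAt s v, ℓ'⟩
  · rw [if_pos hc, if_pos ⟨h, hc⟩]
  · rw [if_neg hc, if_neg fun h' => hc h'.2]

theorem plainCoeff_eq_zero {e e' : K.Enhanced} (h : ¬ K.IsEdge v e.1 e'.1) :
    plainCoeff S v e e' = 0 := if_neg fun h' => h h'.1

/-- The composition of two maps in the cube is given by the product of the two polynomials. -/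
theorem sum_plainCoeff_mul {s : K.State} (hvw : v ≠ w) (hv : s v = false) (hw : s w = false)
    (ℓ : K.Circle s → Label) (ℓ'' : K.Circle (flipAt (flipAt s v) w) → Label) :
    ∑ e', plainCoeff S v ⟨s, ℓ⟩ e' * plainCoeff S w e' ⟨flipAt (flipAt s v) w, ℓ''⟩ =
      labelCoeff ℓ''
        (S.cube.edgePoly (flipAt s v) w * S.cube.edgePoly s v * labelMonomial ℓ) := by
  have hw' : flipAt s v w = false := by rw [flipAt_of_ne s hvw.symm, hw]
  rw [sum_enhanced, Finset.sum_eq_single (flipAt s v)]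
  · simp only [plainCoeff_eq_labelCoeff hv, plainCoeff_eq_labelCoeff hw']
    have h1 := SwapCube.edgePoly_mul_mem (v := w)
      (sub_sum_labelCoeff_mem S (flipAt s v) (S.cube.edgePoly s v * labelMonomial ℓ))
    have h2 := labelCoeff_eq_zero_of_mem S ℓ'' h1
    rw [mul_sub, map_sub, sub_eq_zero, ← mul_assoc, Finset.mul_sum, map_sum] at h2
    rw [h2]
    refine Finset.sum_congr rfl fun ℓ' _ => ?_
    rw [mul_smul_comm, map_zsmul, smul_eq_mul]
  · intro s' _ hs'
    refine Finset.sum_eq_zero fun ℓ' _ => ?_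
    rw [plainCoeff_eq_zero fun h => hs' (SourceSink.eq_flipAt h), zero_mul]
  · simp

theorem sum_plainCoeff_mul_eq_zero {e e'' : K.Enhanced} (hvw : v ≠ w)
    (h : ¬ (e.1 v = false ∧ e.1 w = false ∧ e''.1 = flipAt (flipAt e.1 v) w)) :
    ∑ e', plainCoeff S v e e' * plainCoeff S w e' e'' = 0 := by
  refine Finset.sum_eq_zero fun e' _ => ?_
  by_cases h1 : K.IsEdge v e.1 e'.1
  · by_cases h2 : K.IsEdge w e'.1 e''.1
    · refine absurd ⟨h1.1, ?_, ?_⟩ h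
      · have := h2.1
        rwa [SourceSink.eq_flipAt h1, flipAt_of_ne _ hvw.symm] at this
      · rw [SourceSink.eq_flipAt h2, SourceSink.eq_flipAt h1]
    · rw [plainCoeff_eq_zero h2, mul_zero]
  · rw [plainCoeff_eq_zero h1, zero_mul]

/-- Without signs, the faces of the cube commute. -/
theorem sum_plainCoeff_comm (hvw : v ≠ w) (e e'' : K.Enhanced) :
    ∑ e', plainCoeff S v e e' * plainCoeff S w e' e'' =
      ∑ e', plainCoeff S w e e' * plainCoeff S v e' e'' := by
  by_cases h : e.1 v = false ∧ e.1 w = false ∧ e''.1 = flipAt (flipAt e.1 v) w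
  · obtain ⟨s, ℓ⟩ := e
    obtain ⟨t, ℓ''⟩ := e''
    obtain ⟨hv, hw, rfl⟩ := h
    have key : ∀ (t : K.State) (ht : t = flipAt (flipAt s w) v) (ℓ'' : K.Circle t → Label),
        ∑ e', plainCoeff S w ⟨s, ℓ⟩ e' * plainCoeff S v e' ⟨t, ℓ''⟩ = labelCoeff ℓ''
          (S.cube.edgePoly (flipAt s w) v * S.cube.edgePoly s w * labelMonomial ℓ) := by
      rintro t rfl ℓ''
      exact sum_plainCoeff_mul hvw.symm hw hv ℓ ℓ''
    refine (sum_plainCoeff_mul hvw hv hw ℓ ℓ'').trans ((sub_eq_zero.1 ?_).trans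
      (key _ (flipAt_comm s v w) ℓ'').symm)
    rw [← map_sub, ← sub_mul]
    exact labelCoeff_eq_zero_of_mem S ℓ''
      (Ideal.mul_mem_right _ _ (SwapCube.edgePoly_face s v w))
  · rw [sum_plainCoeff_mul_eq_zero hvw h, sum_plainCoeff_mul_eq_zero hvw.symm]
    rw [flipAt_comm]
    tauto

variable (S) in
include S in
/-- The square of the matrix of the usual differential vanishes. -/
theorem sum_usualEdgeCoeff_mul (e e'' : K.Enhanced) :
    ∑ e', (∑ v, K.usualEdgeCoeff v e e') * (∑ w, K.usualEdgeCoeff w e' e'') = 0 := by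
  set T : Fin K.n → Fin K.n → ℤ := fun v w =>
    ∑ e', K.usualEdgeCoeff v e e' * K.usualEdgeCoeff w e' e'' with hT
  have hT0 : ∀ v w, T v w = cubeSign e.1 v * cubeSign (flipAt e.1 v) w *
      ∑ e', plainCoeff S v e e' * plainCoeff S w e' e'' := by
    intro v w
    rw [hT, Finset.mul_sum]
    refine Finset.sum_congr rfl fun e' _ => ?_
    rw [usualEdgeCoeff_eq S, usualEdgeCoeff_eq S]
    by_cases h : K.IsEdge v e.1 e'.1
    · rw [SourceSink.eq_flipAt h]
      ring
    · rw [plainCoeff_eq_zero h]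
      ring
  have hanti : ∀ v w, T v w = -T w v := by
    intro v w
    rcases eq_or_ne v w with rfl | hvw
    · have : T v v = 0 := by
        refine Finset.sum_eq_zero fun e' _ => ?_
        rw [usualEdgeCoeff_eq S, usualEdgeCoeff_eq S]
        by_cases h : K.IsEdge v e.1 e'.1
        · rw [plainCoeff_eq_zero (v := v) (e := e'), mul_zero, mul_zero]
          intro h'
          have := h'.1
          rw [h.2] at this
          simp at this
        · rw [plainCoeff_eq_zero h, mul_zero, zero_mul]
      rw [this, neg_zero]
    · rw [hT0, hT0, sum_plainCoeff_comm hvw, cubeSign_swap _ hvw, neg_mul]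
  have hsum : ∑ e', (∑ v, K.usualEdgeCoeff v e e') * (∑ w, K.usualEdgeCoeff w e' e'') =
      ∑ v, ∑ w, T v w := by
    simp only [Finset.sum_mul_sum]
    rw [Finset.sum_comm]
    exact Finset.sum_congr rfl fun v _ => Finset.sum_comm
  have h1 : ∑ v, ∑ w, T v w = -∑ v, ∑ w, T v w := by
    conv_lhs => rw [Finset.sum_comm]
    rw [← Finset.sum_neg_distrib]
    refine Finset.sum_congr rfl fun v _ => ?_
    rw [← Finset.sum_neg_distrib]
    exact Finset.sum_congr rfl fun w _ => hanti w v
  rw [hsum]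
  omega

theorem beta_flipAt {s : K.State} (h : s v = false) : K.beta (flipAt s v) = K.beta s + 1 := by
  rw [VirtualDiagram.beta, VirtualDiagram.beta]
  have : (Finset.univ.filter fun w => flipAt s v w = true) =
      insert v (Finset.univ.filter fun w => s w = true) := by
    ext w
    rcases eq_or_ne w v with rfl | hw
    · simp [h]
    · simp [flipAt_of_ne s hw, hw]
  rw [this, Finset.card_insert_of_notMem (by simp [h])]

/-- The partial differentials raise the height by one and preserve the grading. -/
theorem height_grading_of_plainCoeff_ne_zero {e e' : K.Enhanced} (h : plainCoeff S v e e' ≠ 0) :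
    K.height e' = K.height e + 1 ∧ K.grading e' = K.grading e := by
  classical
  obtain ⟨s, ℓ⟩ := e
  obtain ⟨t, ℓ'⟩ := e'
  rw [plainCoeff] at h
  split_ifs at h with hc
  · obtain ⟨he, hcomp⟩ := hc
    obtain rfl := SourceSink.eq_flipAt he
    have hb := beta_flipAt (K := K) (v := v) (s := s) he.1
    constructor
    · simp only [VirtualDiagram.height, hb]
      push_cast
      ring
    · simp only [VirtualDiagram.grading, hb]
      have hdeg : ∑ C, (ℓ' C).deg + 1 = ∑ C, (ℓ C).deg := by
        rw [labelEntry] at h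
        by_cases hm : S.cube.Merges s v
        · rw [if_pos hm] at h
          obtain ⟨P, h1, h2⟩ := S.sum_circles hm rfl (fun C => (ℓ C).deg) (fun C => (ℓ' C).deg)
            fun C C' e => congrArg Label.deg (hcomp C C' e)
          rw [h1, h2]
          dsimp only at h
          revert h
          -- the terms of `m` and `Δ` lower the sum of the degrees by one
          generalize ℓ (S.circA s v) = p
          generalize ℓ (S.circB s v) = q
          generalize ℓ' (S.circA (flipAt s v) v) = r
          cases p <;> cases q <;> cases r <;> intro h <;>
            first | exact absurd rfl h | (simp only [Label.deg]; ring)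
        · rw [if_neg hm] at h
          obtain ⟨P, h1, h2⟩ := S.sum_circles (SwapCube.merges_flipAt.2 hm)
            (flipAt_flipAt s v).symm (fun C => (ℓ' C).deg) (fun C => (ℓ C).deg)
            fun C C' e => congrArg Label.deg (hcomp C' C e.symm).symm
          rw [h1, h2]
          dsimp only at h
          revert h
          -- the terms of `m` and `Δ` lower the sum of the degrees by one
          generalize ℓ (S.circA s v) = p
          generalize ℓ' (S.circA (flipAt s v) v) = q
          generalize ℓ' (S.circB (flipAt s v) v) = r
          cases p <;> cases q <;> cases r <;> intro h <;>
            first | exact absurd rfl h | (simp only [Label.deg]; ring)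
      push_cast
      linarith
  · exact absurd rfl h

theorem matrixMap_apply (c : K.Enhanced → K.Enhanced → ℤ) (R : Type*) [Ring R] (i i' j : ℤ)
    (f : K.Chain R i j) (e' : K.Gen i' j) :
    K.matrixMap c R i i' j f e' = ∑ e : K.Gen i j, c e.1 e'.1 • f e := rfl

/-- Matrices that respect the gradings and have square zero define maps whose composition is
zero. -/
theorem matrixMap_comp_eq_zero {c : K.Enhanced → K.Enhanced → ℤ}
    (hdeg : ∀ e e', c e e' ≠ 0 → K.height e' = K.height e + 1 ∧ K.grading e' = K.grading e)
    (hsq : ∀ e e'', ∑ e', c e e' * c e' e'' = 0) (R : Type*) [Ring R] (i i'' j : ℤ) :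
    K.matrixMap c R (i + 1) i'' j ∘ₗ K.matrixMap c R i (i + 1) j = 0 := by
  classical
  refine LinearMap.ext fun f => funext fun e'' => ?_
  rw [LinearMap.comp_apply, matrixMap_apply]
  simp only [matrixMap_apply, Finset.smul_sum, smul_smul]
  rw [Finset.sum_comm]
  refine Finset.sum_eq_zero fun e _ => ?_
  rw [← Finset.sum_smul]
  have : ∑ e' : K.Gen (i + 1) j, c e'.1 e''.1 * c e.1 e'.1 = 0 := by
    rw [← hsq e.1 e''.1, ← Finset.sum_filter_of_ne (p := fun e' =>
      K.height e' = i + 1 ∧ K.grading e' = j), Finset.sum_subtype (p := fun e' =>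
      K.height e' = i + 1 ∧ K.grading e' = j) _ (by simp)]
    · exact Finset.sum_congr rfl fun e' _ => mul_comm _ _
    · intro e' _ he'
      have := hdeg e.1 e' (left_ne_zero_of_mul he')
      rwa [e.2.1, e.2.2] at this
  rw [this, zero_smul]

end Usual

/-! ### Comparison of the two complexes -/

section Frame

variable {K : VirtualDiagram} (S : SourceSink K) (F : K.Frame) {s t : K.State} {v w : Fin K.n}

/-- The source-sink structure, extended by a fixed orientation of the components without
crossings. -/
def baseDir : K.Point → Bool := Sum.elim S.out fun _ => true

/-- The sign that compares, at a point, the orientation chosen by the frame with that of the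
source-sink structure. -/
def pointSign (s : K.State) (x : K.Point) : ℤ := if F.dir s x = baseDir S x then 1 else -1

theorem pointSign_inl (s : K.State) (h : HalfEdge K.n K.m) :
    pointSign S F s (Sum.inl h) = if F.dir s (Sum.inl h) = S.out h then 1 else -1 := rfl

theorem pointSign_mul_self (s : K.State) (x : K.Point) :
    pointSign S F s x * pointSign S F s x = 1 := by
  rw [pointSign]
  split_ifs <;> rfl

theorem pointSign_eq_of_circle_eq {x y : K.Point} (h : K.circle s x = K.circle s y) :
    pointSign S F s x = pointSign S F s y := by
  rw [S.circle_eq_iff] at h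
  refine rel_of_sameCycle (r := fun x y => pointSign S F s x = pointSign S F s y)
    ⟨fun _ => rfl, Eq.symm, Eq.trans⟩ (fun z => ?_) h
  rcases z with z | l
  · have hflip : ∀ g, F.dir s (Sum.inl g) = !F.dir s (Sum.inl z) → S.out g = !S.out z →
        pointSign S F s (Sum.inl z) = pointSign S F s (Sum.inl g) := by
      intro g h1 h2
      rw [pointSign_inl, pointSign_inl, h1, h2]
      exact if_congr Bool.not_inj_iff.symm rfl rfl
    change _ = pointSign S F s (S.next s (Sum.inl z))
    rw [S.next_inl]
    split_ifs
    · exact hflip _ (F.dir_edge s z) (S.out_edge z)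
    · exact hflip _ (F.dir_arc s z) (S.out_arc s z)
  · rfl

/-- The sign that compares the two orientations of a circle. -/
def circleSign (C : K.Circle s) : ℤ := pointSign S F s (rep C)

theorem circleSign_circle (x : K.Point) : circleSign S F (K.circle s x) = pointSign S F s x :=
  pointSign_eq_of_circle_eq S F (circle_rep _)

/-- The sign that compares, at a crossing, the local orientation with the source-sink structure. It
does not depend on the corner. -/
def crossingSign (v : Fin K.n) : ℤ := if S.out (Sum.inl v, Corner.nw) then -1 else 1

theorem crossingSign_mul_self (v : Fin K.n) : crossingSign S v * crossingSign S v = 1 := by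
  rw [crossingSign]
  split_ifs <;> rfl

theorem localSign_eq (s : K.State) (v : Fin K.n) (c : Corner) :
    F.localSign s v c = circleSign S F (K.circle s (Sum.inl (Sum.inl v, c))) *
      crossingSign S v := by
  obtain ⟨h1, h2, h3⟩ := S.out_corner v
  rw [circleSign_circle, VirtualDiagram.Frame.localSign, pointSign, crossingSign, baseDir,
    Sum.elim_inl]
  cases hn : S.out (Sum.inl v, Corner.nw) <;> cases c <;>
    cases F.dir s (Sum.inl (Sum.inl v, _)) <;> simp [h1, h2, h3, hn, Corner.localDir]

/-- The factor of a label in a change of basis of sign `ε`. -/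
def labelPow (ε : ℤ) (p : Label) : ℤ := if p = Label.X then ε else 1

theorem labelPow_mul_self {ε : ℤ} (h : ε * ε = 1) (p : Label) :
    labelPow ε p * labelPow ε p = 1 := by
  rw [labelPow]
  split_ifs
  · exact h
  · rfl

theorem change_eq (s : K.State) (v : Fin K.n) (c : Corner) (p : Label) :
    F.change s v c p = labelPow (circleSign S F (K.circle s (Sum.inl (Sum.inl v, c)))) p *
      labelPow (crossingSign S v) p := by
  cases p
  · simp [VirtualDiagram.Frame.change, labelPow]
  · simp [VirtualDiagram.Frame.change, labelPow, localSign_eq S]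

/-- Changing the sign of all generators `X` does not affect `m`. -/
theorem labelPow_mulCoeff {ε : ℤ} (h : ε * ε = 1) (p q r : Label) :
    labelPow ε p * labelPow ε q * labelPow ε r * Label.mulCoeff p q r = Label.mulCoeff p q r := by
  cases p <;> cases q <;> cases r <;> simp [labelPow, Label.mulCoeff, h]

/-- Changing the sign of all generators `X` changes that of `Δ`. -/
theorem labelPow_comulCoeff {ε : ℤ} (h : ε * ε = 1) (p q r : Label) :
    labelPow ε p * labelPow ε q * labelPow ε r * Label.comulCoeff p q r =
      ε * Label.comulCoeff p q r := by
  cases p <;> cases q <;> cases r <;> simp [labelPow, Label.comulCoeff, h]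

/-- The sign that compares the basis elements for the orientations chosen by the frame with those
for the source-sink structure. -/
def labelSign (e : K.Enhanced) : ℤ := ∏ C, labelPow (circleSign S F C) (e.2 C)

theorem circleSign_mul_self (C : K.Circle s) : circleSign S F C * circleSign S F C = 1 :=
  pointSign_mul_self S F s _

theorem labelSign_mul_self (e : K.Enhanced) : labelSign S F e * labelSign S F e = 1 := by
  rw [labelSign, ← Finset.prod_mul_distrib]
  exact Finset.prod_eq_one fun C _ => labelPow_mul_self (circleSign_mul_self S F C) _

theorem compareSign_eq {C : K.Circle s} {C' : K.Circle t} (h : C.1 = C'.1) :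
    F.compareSign s t C.1 = circleSign S F C * circleSign S F C' := by
  have hs : ∀ x ∈ C.1, circleSign S F C = pointSign S F s x := by
    intro x hx
    rw [← circleSign_circle, (mem_circle_iff S).1 hx]
  have ht : ∀ x ∈ C.1, circleSign S F C' = pointSign S F t x := by
    intro x hx
    rw [← circleSign_circle, (mem_circle_iff S).1 (h ▸ hx)]
  have hx : ∀ x ∈ C.1, F.dir s x = F.dir t x ↔ circleSign S F C * circleSign S F C' = 1 := by
    intro x hx
    rw [hs x hx, ht x hx, pointSign, pointSign]
    cases F.dir s x <;> cases F.dir t x <;> cases baseDir S x <;> simp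
  have h0 : rep C ∈ C.1 := (mem_circle_iff S).2 (circle_rep C)
  rw [VirtualDiagram.Frame.compareSign]
  by_cases hc : circleSign S F C * circleSign S F C' = 1
  · rw [if_pos fun x hxC => (hx x hxC).2 hc, hc]
  · rw [if_neg fun hall => hc ((hx _ h0).1 (hall _ h0))]
    have hsq : (circleSign S F C * circleSign S F C') *
        (circleSign S F C * circleSign S F C') = 1 := by
      rw [mul_mul_mul_comm, circleSign_mul_self, circleSign_mul_self, one_mul]
    exact ((mul_self_eq_one_iff.1 hsq).resolve_left hc).symm

open Classical in
/-- The factor of a circle in `commonSign`. -/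
def commonFactor (e e' : K.Enhanced) (C : K.Circle e.1) : ℤ :=
  if C.1 ∈ K.circles e'.1 ∧ e.2 C = Label.X then F.compareSign e.1 e'.1 C.1 else 1

theorem commonFactor_mul {e e' : K.Enhanced} (hc : K.Compatible e e') {C : K.Circle e.1}
    {C' : K.Circle e'.1} (h : C.1 = C'.1) :
    commonFactor F e e' C * labelPow (circleSign S F C) (e.2 C) =
      labelPow (circleSign S F C') (e'.2 C') := by
  have hm : C.1 ∈ K.circles e'.1 := h ▸ C'.2
  rw [commonFactor, ← hc C C' h, compareSign_eq S F h]
  cases e.2 C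
  · simp [labelPow]
  · simp only [hm, labelPow, and_self, if_true]
    rw [mul_right_comm, circleSign_mul_self, one_mul]

theorem commonFactor_of_notMem {e e' : K.Enhanced} {C : K.Circle e.1} (h : C.1 ∉ K.circles e'.1) :
    commonFactor F e e' C = 1 := by
  rw [commonFactor, if_neg fun h' => h h'.1]

/-- Circles common to both states contribute to `commonSign` as they do to the two signs
`labelSign`; the remaining factors are those of the circles at the crossing. -/
theorem commonSign_of_merge (h : S.cube.Merges s v) {ℓ : K.Circle s → Label}
    {ℓ' : K.Circle (flipAt s v) → Label} (hc : K.Compatible ⟨s, ℓ⟩ ⟨flipAt s v, ℓ'⟩) :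
    F.commonSign ⟨s, ℓ⟩ ⟨flipAt s v, ℓ'⟩ =
      labelSign S F ⟨s, ℓ⟩ * labelSign S F ⟨flipAt s v, ℓ'⟩ *
        (labelPow (circleSign S F (S.circA s v)) (ℓ (S.circA s v)) *
        labelPow (circleSign S F (S.circB s v)) (ℓ (S.circB s v)) *
        labelPow (circleSign S F (S.circA (flipAt s v) v)) (ℓ' (S.circA (flipAt s v) v))) := by
  obtain ⟨P, h1, h2⟩ := S.prod_circles h rfl
    (fun C => commonFactor F ⟨s, ℓ⟩ ⟨flipAt s v, ℓ'⟩ C * labelPow (circleSign S F C) (ℓ C))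
    (fun C' => labelPow (circleSign S F C') (ℓ' C')) fun C C' e => commonFactor_mul S F hc e
  rw [Finset.prod_mul_distrib,
    commonFactor_of_notMem F (e' := ⟨flipAt s v, ℓ'⟩) (S.circA_notMem h),
    commonFactor_of_notMem F (e' := ⟨flipAt s v, ℓ'⟩) (S.circB_notMem h), one_mul, one_mul] at h1
  change F.commonSign ⟨s, ℓ⟩ ⟨flipAt s v, ℓ'⟩ * labelSign S F ⟨s, ℓ⟩ = _ at h1
  change labelSign S F ⟨flipAt s v, ℓ'⟩ = _ at h2
  have q := labelSign_mul_self S F ⟨s, ℓ⟩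
  have q' := labelPow_mul_self (circleSign_mul_self S F (S.circA (flipAt s v) v))
    (ℓ' (S.circA (flipAt s v) v))
  rw [h2, ← mul_one (F.commonSign _ _), ← q]
  linear_combination labelSign S F ⟨s, ℓ⟩ * h1 - labelSign S F ⟨s, ℓ⟩ * P *
    (labelPow (circleSign S F (S.circA s v)) (ℓ (S.circA s v)) *
        labelPow (circleSign S F (S.circB s v)) (ℓ (S.circB s v))) * q'

/-- The analogue of `commonSign_of_merge` for a splitting edge. -/
theorem commonSign_of_split (h : ¬ S.cube.Merges s v) {ℓ : K.Circle s → Label}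
    {ℓ' : K.Circle (flipAt s v) → Label} (hc : K.Compatible ⟨s, ℓ⟩ ⟨flipAt s v, ℓ'⟩) :
    F.commonSign ⟨s, ℓ⟩ ⟨flipAt s v, ℓ'⟩ =
      labelSign S F ⟨s, ℓ⟩ * labelSign S F ⟨flipAt s v, ℓ'⟩ *
        (labelPow (circleSign S F (S.circA s v)) (ℓ (S.circA s v)) *
        labelPow (circleSign S F (S.circA (flipAt s v) v)) (ℓ' (S.circA (flipAt s v) v)) *
        labelPow (circleSign S F (S.circB (flipAt s v) v)) (ℓ' (S.circB (flipAt s v) v))) := by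
  have h' : S.cube.Merges (flipAt s v) v := SwapCube.merges_flipAt.2 h
  obtain ⟨P, h2, h1⟩ := S.prod_circles h' (flipAt_flipAt s v).symm
    (fun C' => labelPow (circleSign S F C') (ℓ' C'))
    (fun C => commonFactor F ⟨s, ℓ⟩ ⟨flipAt s v, ℓ'⟩ C * labelPow (circleSign S F C) (ℓ C))
    fun C' C e => (commonFactor_mul S F hc e.symm).symm
  have hn : (S.circA s v).1 ∉ K.circles (flipAt s v) := by
    have := S.circA_flipAt_notMem h'
    rwa [flipAt_flipAt] at this
  rw [Finset.prod_mul_distrib,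
    commonFactor_of_notMem F (e' := ⟨flipAt s v, ℓ'⟩) hn, one_mul] at h1
  change F.commonSign ⟨s, ℓ⟩ ⟨flipAt s v, ℓ'⟩ * labelSign S F ⟨s, ℓ⟩ = _ at h1
  change labelSign S F ⟨flipAt s v, ℓ'⟩ = _ at h2
  have q := labelSign_mul_self S F ⟨s, ℓ⟩
  have qa := labelPow_mul_self (circleSign_mul_self S F (S.circA (flipAt s v) v))
    (ℓ' (S.circA (flipAt s v) v))
  have qb := labelPow_mul_self (circleSign_mul_self S F (S.circB (flipAt s v) v))
    (ℓ' (S.circB (flipAt s v) v))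
  rw [h2, ← mul_one (F.commonSign _ _), ← q]
  set a := labelPow (circleSign S F (S.circA (flipAt s v) v)) (ℓ' (S.circA (flipAt s v) v))
  set b := labelPow (circleSign S F (S.circB (flipAt s v) v)) (ℓ' (S.circB (flipAt s v) v))
  linear_combination labelSign S F ⟨s, ℓ⟩ * h1 - labelSign S F ⟨s, ℓ⟩ * P *
    labelPow (circleSign S F (S.circA s v)) (ℓ (S.circA s v)) * (qa * b ^ 2 + qb)

theorem injOn_ord (s : K.State) : Set.InjOn (F.ord s) (S.cube.cycles s) := by
  rw [← S.circles_eq_cycles]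
  exact F.ord_inj s

theorem mul_eq_of_signs {θ o o' a b c p q r m m' : ℤ} (ha : a * a = 1) (hb : b * b = 1)
    (hc : c * c = 1) (hm : p * q * r * m = m') :
    θ * (a * b * c) * o * o' * (a * p) * (b * q) * (c * r) * m = θ * (o * o' * m') := by
  subst hm
  linear_combination θ * o * o' * p * q * r * m * (ha * b ^ 2 * c ^ 2 + hb * c ^ 2 + hc)

/-- After the change of orientations, the partial differentials of the two complexes differ only by
a sign that depends on the edge of the cube. At a splitting edge, the sign `crossingSign` of `Δ` is
compensated by the order of the two new circles. -/
theorem edgeCoeff_eq (v : Fin K.n) (e e' : K.Enhanced) :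
    F.edgeCoeff v e e' = labelSign S F e * labelSign S F e' *
      (S.cube.edgeSign F.ord e.1 v * plainCoeff S v e e') := by
  obtain ⟨s, ℓ⟩ := e
  obtain ⟨t, ℓ'⟩ := e'
  rw [VirtualDiagram.Frame.edgeCoeff, plainCoeff]
  by_cases h : K.IsEdge v s t ∧ K.Compatible ⟨s, ℓ⟩ ⟨t, ℓ'⟩
  · rw [if_pos h, if_pos h]
    obtain rfl := SourceSink.eq_flipAt h.1
    have hs : s v = false := h.1.1
    obtain ⟨e1, e2⟩ := S.fst_snd_of_A hs
    have c1 : K.circle s (Sum.inl (Sum.inl v, Corner.nw)) = S.circA s v := e1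
    have c2 : K.circle s (Sum.inl (Sum.inl v, Corner.se)) = S.circB s v := e2
    have hε := crossingSign_mul_self S v
    rw [labelEntry, SwapCube.edgeSign]
    dsimp only
    rw [e1, e2, S.circA_val, S.circB_val, S.common_eq]
    by_cases hm : S.cube.Merges s v
    · have hA : K.fst (flipAt s v) v = S.circA (flipAt s v) v := by
        have hAB : S.circA (flipAt s v) v = S.circB (flipAt s v) v := by
          by_contra hne
          exact SwapCube.merges_flipAt.1 ((S.merges_iff_circ_ne _ v).2 hne) hm
        rcases S.fst_snd (flipAt s v) v with ⟨h1, _⟩ | ⟨h1, _⟩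
        · exact h1
        · rw [h1, hAB]
      have c3 : K.circle (flipAt s v) (Sum.inl (Sum.inl v, Corner.nw)) =
        S.circA (flipAt s v) v := hA
      rw [if_pos hm, if_pos hm, if_pos ((S.isMerge_iff v s).2 hm), hA, S.circA_val,
        commonSign_of_merge S F hm h.2, change_eq S, change_eq S, change_eq S, c1, c2, c3]
      have qa := labelPow_mul_self (circleSign_mul_self S F (S.circA s v)) (ℓ (S.circA s v))
      have qb := labelPow_mul_self (circleSign_mul_self S F (S.circB s v)) (ℓ (S.circB s v))
      have qc := labelPow_mul_self (circleSign_mul_self S F (S.circA (flipAt s v) v))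
        (ℓ' (S.circA (flipAt s v) v))
      have qm := labelPow_mulCoeff hε (ℓ (S.circA s v)) (ℓ (S.circB s v))
        (ℓ' (S.circA (flipAt s v) v))
      exact mul_eq_of_signs qa qb qc qm
    · rw [if_neg hm, if_neg hm, if_neg (mt (S.isMerge_iff v s).1 hm),
        if_pos ((S.isSplit_iff v s).2 hm), commonSign_of_split S F hm h.2, change_eq S,
        change_eq S, change_eq S, c1]
      have hm' := SwapCube.merges_flipAt.2 hm
      have qa := labelPow_mul_self (circleSign_mul_self S F (S.circA s v)) (ℓ (S.circA s v))
      have qb := labelPow_mul_self (circleSign_mul_self S F (S.circA (flipAt s v) v))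
        (ℓ' (S.circA (flipAt s v) v))
      have qc := labelPow_mul_self (circleSign_mul_self S F (S.circB (flipAt s v) v))
        (ℓ' (S.circB (flipAt s v) v))
      have qm := labelPow_comulCoeff hε (ℓ (S.circA s v)) (ℓ' (S.circA (flipAt s v) v))
        (ℓ' (S.circB (flipAt s v) v))
      cases ho : S.out (Sum.inl v, Corner.nw)
      · obtain ⟨h3, h4⟩ := S.fst_snd_of_out_eq_false (s := flipAt s v) ho
        have c3 : K.circle (flipAt s v) (Sum.inl (Sum.inl v, Corner.nw)) =
          S.circA (flipAt s v) v := h3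
        have c4 : K.circle (flipAt s v) (Sum.inl (Sum.inl v, Corner.se)) =
          S.circB (flipAt s v) v := h4
        have hε1 : crossingSign S v = 1 := by rw [crossingSign, ho]; rfl
        rw [hε1, one_mul] at qm
        rw [h3, h4, c3, c4, hε1, S.circA_val, S.circB_val]
        rw [mul_eq_of_signs qa qb qc qm]
        ring
      · have ht : flipAt s v v = true := by rw [flipAt_self, hs]; rfl
        obtain ⟨h3, h4⟩ := S.fst_snd_of_B ht ho
        have c3 : K.circle (flipAt s v) (Sum.inl (Sum.inl v, Corner.nw)) =
          S.circB (flipAt s v) v := h3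
        have c4 : K.circle (flipAt s v) (Sum.inl (Sum.inl v, Corner.se)) =
          S.circA (flipAt s v) v := h4
        have hε1 : crossingSign S v = -1 := by rw [crossingSign, ho]; rfl
        have hne : F.ord (flipAt s v) (S.cube.cyc (flipAt s v) (S.cube.b v)) ≠
            F.ord (flipAt s v) (S.cube.cyc (flipAt s v) (S.cube.a v)) := fun e =>
          SwapCube.merges_iff_cyc_ne.1 hm' (injOn_ord S F _ SwapCube.cyc_mem_cycles
            SwapCube.cyc_mem_cycles e).symm
        rw [hε1, neg_one_mul] at qm
        rw [h3, h4, c3, c4, hε1, S.circA_val, S.circB_val, orderSign_swap _ hne,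
          comulCoeff_comm _ (ℓ' (S.circB (flipAt s v) v))]
        rw [mul_right_comm _ (labelPow (circleSign S F (S.circB (flipAt s v) v)) _ * _),
          mul_eq_of_signs qa qb qc qm]
        ring
  · rw [if_neg h, if_neg h, mul_zero, mul_zero]

end Frame

/-! ### Isomorphism of the homology -/

section Homology

/-- Isomorphic three-term sequences have isomorphic homology. -/
theorem nonempty_homology_equiv {R A B C A' B' C' : Type*} [Ring R] [AddCommGroup A]
    [AddCommGroup B] [AddCommGroup C] [AddCommGroup A'] [AddCommGroup B'] [AddCommGroup C']
    [Module R A] [Module R B] [Module R C] [Module R A'] [Module R B'] [Module R C']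
    (f : A →ₗ[R] B) (g : B →ₗ[R] C) (f' : A' →ₗ[R] B') (g' : B' →ₗ[R] C')
    (a : A ≃ₗ[R] A') (b : B ≃ₗ[R] B') (c : C ≃ₗ[R] C')
    (hf : ∀ x, b (f x) = f' (a x)) (hg : ∀ x, c (g x) = g' (b x)) :
    Nonempty ((LinearMap.ker g ⧸ (LinearMap.range f).comap (LinearMap.ker g).subtype) ≃ₗ[R]
      LinearMap.ker g' ⧸ (LinearMap.range f').comap (LinearMap.ker g').subtype) := by
  have hker : (LinearMap.ker g).map (b : B →ₗ[R] B') = LinearMap.ker g' := by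
    ext y
    simp only [Submodule.mem_map, LinearMap.mem_ker]
    constructor
    · rintro ⟨x, hx, rfl⟩
      rw [LinearEquiv.coe_coe, ← hg, hx, map_zero]
    · intro hy
      refine ⟨b.symm y, ?_, by simp⟩
      apply c.injective
      rw [hg, LinearEquiv.apply_symm_apply, hy, map_zero]
  refine ⟨Submodule.Quotient.equiv _ _ (b.ofSubmodules _ _ hker) ?_⟩
  ext ⟨y, hy⟩
  simp only [Submodule.mem_map, Submodule.mem_comap, LinearMap.mem_range, Submodule.subtype_apply]
  constructor
  · rintro ⟨x, ⟨z, hz⟩, hx⟩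
    refine ⟨a z, ?_⟩
    rw [← hf, hz]
    exact congrArg Subtype.val hx
  · rintro ⟨z, hz⟩
    have hz' : b (f (a.symm z)) = y := by rw [hf, LinearEquiv.apply_symm_apply, hz]
    have hmem : f (a.symm z) ∈ LinearMap.ker g := by
      rw [LinearMap.mem_ker]
      apply c.injective
      rw [hg, hz', map_zero]
      exact hy
    exact ⟨⟨_, hmem⟩, ⟨_, rfl⟩, Subtype.ext hz'⟩

variable {K : VirtualDiagram}

/-- The automorphism of a chain space that multiplies the basis elements by signs. -/
def signEquiv (θ : K.Enhanced → ℤ) (hθ : ∀ e, θ e * θ e = 1) (R : Type*) [Ring R] (i j : ℤ) :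
    K.Chain R i j ≃ₗ[R] K.Chain R i j :=
  LinearEquiv.ofInvolutive
    { toFun := fun f e => θ e.1 • f e
      map_add' := fun f g => funext fun e => smul_add _ _ _
      map_smul' := fun r f => funext fun e => smul_comm (θ e.1) r (f e) }
    fun f => funext fun e => by
      change θ e.1 • θ e.1 • f e = f e
      rw [smul_smul, hθ, one_smul]

theorem signEquiv_apply (θ : K.Enhanced → ℤ) (hθ : ∀ e, θ e * θ e = 1) (R : Type*) [Ring R]
    (i j : ℤ) (f : K.Chain R i j) (e : K.Gen i j) : signEquiv θ hθ R i j f e = θ e.1 • f e := rfl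

theorem signEquiv_matrixMap {c c' : K.Enhanced → K.Enhanced → ℤ} (θ : K.Enhanced → ℤ)
    (hθ : ∀ e, θ e * θ e = 1) (hc : ∀ e e', c e e' = θ e * θ e' * c' e e') (R : Type*) [Ring R]
    (i i' j : ℤ) (f : K.Chain R i j) :
    signEquiv θ hθ R i' j (K.matrixMap c R i i' j f) =
      K.matrixMap c' R i i' j (signEquiv θ hθ R i j f) := by
  funext e'
  rw [signEquiv_apply, matrixMap_apply, matrixMap_apply, Finset.smul_sum]
  refine Finset.sum_congr rfl fun e _ => ?_
  rw [signEquiv_apply, smul_smul, smul_smul, hc]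
  congr 1
  linear_combination θ e.1 * c' e.1 e'.1 * hθ e'.1

end Homology

/-- For an orientable atom, the partial differentials of the two complexes agree up to a rescaling
of the basis elements by signs. -/
theorem exists_edgeCoeff_eq {K : VirtualDiagram} (S : SourceSink K) (F : K.Frame) :
    ∃ θ : K.Enhanced → ℤ, (∀ e, θ e * θ e = 1) ∧
      ∀ v e e', F.edgeCoeff v e e' = θ e * θ e' * K.usualEdgeCoeff v e e' := by
  have hord := injOn_ord S F
  obtain ⟨τ, h1, h2⟩ := exists_coboundary
    (g := fun s v => S.cube.edgeSign F.ord s v * cubeSign s v)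
    (fun s v => by
      rw [mul_mul_mul_comm, SwapCube.edgeSign_mul_self, cubeSign_mul_self, one_mul])
    (fun s v => by rw [SwapCube.edgeSign_flipAt hord, cubeSign_flipAt_self])
    (fun s v w hvw => by
      have e1 := SwapCube.edgeSign_face hord s hvw
      have e2 := cubeSign_face s hvw
      linear_combination (cubeSign s v * cubeSign (flipAt s v) w *
        (cubeSign s w * cubeSign (flipAt s w) v)) * e1 - e2)
  refine ⟨fun e => labelSign S F e * τ e.1, fun e => ?_, fun v e e' => ?_⟩
  · rw [mul_mul_mul_comm, labelSign_mul_self, h1, one_mul]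
  · -- the quotient of the signs of the two complexes is the coboundary of `τ`
    rw [edgeCoeff_eq S, usualEdgeCoeff_eq S]
    by_cases h : K.IsEdge v e.1 e'.1
    · have h3 : S.cube.edgeSign F.ord e.1 v * cubeSign e.1 v = τ e.1 * τ e'.1 := by
        rw [SourceSink.eq_flipAt h]
        exact h2 e.1 v
      have h4 : S.cube.edgeSign F.ord e.1 v = τ e.1 * τ e'.1 * cubeSign e.1 v := by
        linear_combination cubeSign e.1 v * h3 -
          S.cube.edgeSign F.ord e.1 v * cubeSign_mul_self e.1 v
      rw [h4]
      ring
    · rw [plainCoeff_eq_zero h]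
      ring

end VirtualKhovanov

end

open VirtualKhovanov in
theorem mainTheorem3 (R : Type*) [Ring R] (K : VirtualKhovanov.VirtualDiagram)
    (hK : K.atom.IsOrientable) (F : K.Frame) :
    (∀ i j : ℤ, F.d R (i + 1) (i + 2) j ∘ₗ F.d R i (i + 1) j = 0) ∧
    (∀ i j : ℤ, K.usualD R (i + 1) (i + 2) j ∘ₗ K.usualD R i (i + 1) j = 0) ∧
    ∀ i j : ℤ, Nonempty (F.Kh R i j ≃ₗ[R] K.UsualKh R i j) := by
  obtain ⟨S⟩ := nonempty_sourceSink hK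
  obtain ⟨θ, hθ, hc⟩ := exists_edgeCoeff_eq S F
  have hc' : ∀ e e', ∑ v, F.edgeCoeff v e e' = θ e * θ e' * ∑ v, K.usualEdgeCoeff v e e' := by
    intro e e'
    rw [Finset.mul_sum]
    exact Finset.sum_congr rfl fun v _ => hc v e e'
  have hdeg : ∀ e e', ∑ v, K.usualEdgeCoeff v e e' ≠ 0 →
      K.height e' = K.height e + 1 ∧ K.grading e' = K.grading e := by
    intro e e' h
    obtain ⟨v, _, hv⟩ := Finset.exists_ne_zero_of_sum_ne_zero h
    rw [usualEdgeCoeff_eq S] at hv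
    exact height_grading_of_plainCoeff_ne_zero (right_ne_zero_of_mul hv)
  refine ⟨fun i j => ?_, fun i j => ?_, fun i j => ?_⟩
  · refine matrixMap_comp_eq_zero (fun e e' h => ?_) (fun e e'' => ?_) R i (i + 2) j
    · rw [hc'] at h
      exact hdeg e e' (right_ne_zero_of_mul h)
    · have : ∀ e', (∑ v, F.edgeCoeff v e e') * (∑ v, F.edgeCoeff v e' e'') =
          θ e * θ e'' * ((∑ v, K.usualEdgeCoeff v e e') * ∑ v, K.usualEdgeCoeff v e' e'') := by
        intro e'
        rw [hc', hc']
        linear_combination (θ e * θ e'' * (∑ v, K.usualEdgeCoeff v e e') *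
          ∑ v, K.usualEdgeCoeff v e' e'') * hθ e'
      simp only [this]
      rw [← Finset.mul_sum, sum_usualEdgeCoeff_mul S, mul_zero]
  · exact matrixMap_comp_eq_zero hdeg (sum_usualEdgeCoeff_mul S) R i (i + 2) j
  · exact nonempty_homology_equiv _ _ _ _ (signEquiv θ hθ R (i - 1) j) (signEquiv θ hθ R i j)
      (signEquiv θ hθ R (i + 1) j) (signEquiv_matrixMap θ hθ hc' R (i - 1) i j)
      (signEquiv_matrixMap θ hθ hc' R i (i + 1) j)
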